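/- Let $(X,\mu)$ be a measure space, let $\mathcal H$ be a complex Hilbert space, and let $1<p,q<\infty$. For $1\le r<\infty$ let $\ell^r(\mathcal H)$ be the Schatten ideal of all compact operators $T$ on $\mathcal H$ with $\mathrm{Trace}\big((T^*T)^{r/2}\big)<\infty$, with the norm $\|T\|_r=\mathrm{Trace}\big((T^*T)^{r/2}\big)^{1/r}$, and let $L^r(X,\ell^r(\mathcal H))$ be the Lebesgue–Bochner space of ($\mu$-a.e. classes of) strongly measurable functions $f:X\to\ell^r(\mathcal H)$ with $\|f\|_r^r=\int_X \mathrm{Trace}\big((f(x)^*f(x))^{r/2}\big)\,d\mu(x)<\infty$. For a bounded operator $T$ on $\mathcal H$ let $T=\mathrm{sign}(T)\,|T|$ be its polar decomposition, where $|T|=(T^*T)^{1/2}$ and $\mathrm{sign}(T)$ is the partial isometry that vanishes on $\ker T$. Denote by $S(B)$ the unit sphere of a normed space $B$. Then the Mazur map $$M_{p,q}:\ S\big(L^p(X,\ell^p(\mathcal H))\big)\longrightarrow S\big(L^q(X,\ell^q(\mathcal H))\big),\qquad M_{p,q}(f)(x)=\mathrm{sign}(f(x))\,|f(x)|^{p/q}\quad\text{for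 }\mu\text{-a.e. }x\in X,$$ is well defined and is a uniformly continuous homeomorphism whose inverse is also uniformly continuous. -/

import Mathlib

open scoped ENNReal NNReal

set_option linter.unusedSectionVars false

section Schatten

universe u

variable {H : Type u} [NormedAddCommGroup H] [InnerProductSpace ℂ H] [CompleteSpace H]

/-- The trace of a positive operator `A`, with values in `[0, ∞]`: the sum of `⟨e, A e⟩` over the
vectors `e` of an orthonormal Hilbert basis. For `A ≥ 0` any Hilbert basis gives the same value, by
`SchattenAux.opTrace_eq` below. -/
noncomputable def opTrace (A : H →L[ℂ] H) : ℝ≥0∞ :=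
  ∑' e : (exists_hilbertBasis ℂ H).choose, ENNReal.ofReal (inner ℂ (e : H) (A e)).re

namespace SchattenAux

/-! Auxiliary facts: basis independence of the trace, existence and uniqueness of the polar
decomposition, and the triangle inequality for the Schatten norms. -/

theorem op_mul_apply (A B : H →L[ℂ] H) (x : H) : (A * B) x = A (B x) := rfl

theorem cfc_apply_eigenvector {a : H →L[ℂ] H} (ha : IsSelfAdjoint a) {t : ℝ} {v : H}
    (hv : a v = (t : ℂ) • v) {f : ℝ → ℝ} (hf : Continuous f) :
    cfc f a v = (f t : ℂ) • v := by
  by_cases hv0 : v = 0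
  · simp [hv0]
  have ht : t ∈ spectrum ℝ a := by
    rw [spectrum.mem_iff]
    intro hu
    obtain ⟨u, hu⟩ := hu
    apply hv0
    have h1 : (u : H →L[ℂ] H) v = 0 := by
      rw [hu]; simp [hv, Algebra.algebraMap_eq_smul_one]
    have h2 : ((↑u⁻¹ : H →L[ℂ] H) * (u : H →L[ℂ] H)) v = v := by
      rw [u.inv_mul]; rfl
    rw [op_mul_apply, h1, map_zero] at h2; exact h2.symm
  have key : ∀ g : C(spectrum ℝ a, ℝ), cfcHom ha g v = ((g ⟨t, ht⟩ : ℝ) : ℂ) • v := by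
    intro g
    induction g using ContinuousMap.induction_on_of_compact with
    | const r =>
      have := AlgHomClass.commutes (cfcHom ha : C(spectrum ℝ a, ℝ) →⋆ₐ[ℝ] (H →L[ℂ] H)) r
      change (cfcHom ha (algebraMap ℝ C(spectrum ℝ a, ℝ) r)) v = _
      rw [this]
      simp [Algebra.algebraMap_eq_smul_one]
    | id =>
      rw [cfcHom_id ha]; simpa using hv
    | star_id =>
      rw [map_star, cfcHom_id ha, ha.star_eq]; simpa using hv
    | add f g hf hg =>
      rw [map_add, add_apply, hf, hg]; simp [add_smul]
    | mul f g hf hg =>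
      rw [map_mul, op_mul_apply, hg, map_smul, hf, smul_smul, ContinuousMap.mul_apply, Complex.ofReal_mul, mul_comm]
    | frequently f hf =>
      have hcl : IsClosed {g : C(spectrum ℝ a, ℝ) | cfcHom ha g v = ((g ⟨t, ht⟩ : ℝ) : ℂ) • v} := by
        refine isClosed_eq ?_ ?_
        · have h1 := cfcHom_continuous (R := ℝ) ha
          fun_prop
        · have : Continuous fun g : C(spectrum ℝ a, ℝ) => g ⟨t, ht⟩ := by fun_prop
          fun_prop
      exact hcl.mem_of_frequently_of_tendsto hf Filter.tendsto_id
  rw [cfc_apply f a ha hf.continuousOn, key]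
  rfl

theorem rpow_apply_eigenvector {a : H →L[ℂ] H} (ha : 0 ≤ a) {t : ℝ} {v : H}
    (hv : a v = (t : ℂ) • v) {r : ℝ} (hr : 0 ≤ r) :
    (a ^ r) v = ((t ^ r : ℝ) : ℂ) • v := by
  rw [CFC.rpow_eq_cfc_real ha]
  exact cfc_apply_eigenvector (IsSelfAdjoint.of_nonneg ha) hv (Real.continuous_rpow_const hr)

theorem exists_eigenbasis {A : H →L[ℂ] H} (hA : IsSelfAdjoint A) (hc : IsCompactOperator A) :
    ∃ (ι : Type u) (b : HilbertBasis ι ℂ H) (c : ι → ℂ), ∀ i, A (b i) = c i • b i := by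
  have hs : (A : H →ₗ[ℂ] H).IsSymmetric := hA.isSymmetric
  have hbot : (⨆ μ, Module.End.eigenspace (A : H →ₗ[ℂ] H) μ)ᗮ = ⊥ :=
    A.orthogonalComplement_iSup_eigenspaces_eq_bot hc hs
  have hcl : ∀ μ : ℂ, CompleteSpace (Module.End.eigenspace (A : H →ₗ[ℂ] H) μ) := by
    intro μ
    have : IsClosed ((Module.End.eigenspace (A : H →ₗ[ℂ] H) μ : Submodule ℂ H) : Set H) := by
      have : ((Module.End.eigenspace (A : H →ₗ[ℂ] H) μ : Submodule ℂ H) : Set H)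
          = {v | A v = μ • v} := by
        ext v; simp
      rw [this]
      exact isClosed_eq A.continuous (by fun_prop)
    exact this.completeSpace_coe
  choose w b hb using fun μ : ℂ => exists_hilbertBasis ℂ (Module.End.eigenspace (A : H →ₗ[ℂ] H) μ)
  have hon := hs.orthogonalFamily_eigenspaces.orthonormal_sigma_orthonormal
    (v_family := fun μ => b μ) (fun μ => (b μ).orthonormal)
  refine ⟨Σ μ, w μ, HilbertBasis.mkOfOrthogonalEqBot hon ?_, fun a => a.1, ?_⟩
  · rw [← hbot]
    apply le_antisymm
    · rw [← Submodule.iInf_orthogonal]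
      refine le_iInf fun μ => ?_
      intro v hv x hx
      have h1 : ∀ y : Module.End.eigenspace (A : H →ₗ[ℂ] H) μ, inner ℂ (y : H) v = 0 := by
        intro y
        have hd := (b μ).dense_span
        have hy : y ∈ (Submodule.span ℂ (Set.range (b μ))).topologicalClosure := by
          rw [hd]; trivial
        have hclosed : IsClosed {y : Module.End.eigenspace (A : H →ₗ[ℂ] H) μ |
          inner ℂ (y : H) v = 0} := isClosed_eq (by fun_prop) (by fun_prop)
        refine hclosed.closure_subset_iff.2 ?_ hy
        intro z hz
        induction hz using Submodule.span_induction with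
        | mem z hz =>
          obtain ⟨i, rfl⟩ := hz
          exact hv _ (Submodule.subset_span ⟨⟨μ, i⟩, rfl⟩)
        | zero => simp
        | add x y _ _ hx hy =>
          simp only [Set.mem_ofPred_eq] at *
          simp [hx, hy]
        | smul a x _ hx =>
          simp only [Set.mem_ofPred_eq] at *
          simp [hx]
      exact h1 ⟨x, hx⟩
    · apply Submodule.orthogonal_le
      rw [Submodule.span_le]
      rintro _ ⟨a, rfl⟩
      exact Submodule.mem_iSup_of_mem a.1 (b a.1 a.2).2
  · intro a
    rw [HilbertBasis.coe_mkOfOrthogonalEqBot]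
    exact Module.End.mem_eigenspace_iff.1 (b a.1 a.2).2

theorem enorm_sq_eq_tsum {ι : Type*} (b : HilbertBasis ι ℂ H) (x : H) :
    ‖x‖ₑ ^ 2 = ∑' i, ‖inner ℂ (b i) x‖ₑ ^ 2 := by
  have h := b.hasSum_inner_mul_inner x x
  have h1 : ∀ i, inner ℂ x (b i) * inner ℂ (b i) x = ((‖inner ℂ (b i) x‖ ^ 2 : ℝ) : ℂ) := by
    intro i
    rw [← inner_conj_symm, ← Complex.normSq_eq_conj_mul_self, Complex.normSq_eq_norm_sq]
  simp_rw [h1] at h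
  rw [inner_self_eq_norm_sq_to_K] at h
  have h2 : HasSum (fun i => ‖inner ℂ (b i) x‖ ^ 2) (‖x‖ ^ 2) := by
    have := Complex.hasSum_re h
    simpa [← Complex.ofReal_pow] using this
  have h3 := ENNReal.ofReal_tsum_of_nonneg (fun i => by positivity) h2.summable
  rw [h2.tsum_eq] at h3
  simpa [ENNReal.ofReal_pow, ofReal_norm] using h3

theorem tsum_enorm_inner_sq_le {ι : Type*} {v : ι → H} (hv : Orthonormal ℂ v) (x : H) :
    ∑' i, ‖inner ℂ (v i) x‖ₑ ^ 2 ≤ ‖x‖ₑ ^ 2 := by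
  have h := hv.tsum_inner_products_le (x := x)
  have h3 := ENNReal.ofReal_tsum_of_nonneg (fun i => by positivity) (hv.inner_products_summable (x := x))
  have h4 := ENNReal.ofReal_le_ofReal h
  rw [h3] at h4
  simpa [ENNReal.ofReal_pow, ofReal_norm] using h4

theorem tsum_orthonormal_le {ι κ : Type*} {v : ι → H} (hv : Orthonormal ℂ v)
    (c : HilbertBasis κ ℂ H) (S : H →L[ℂ] H) :
    ∑' i, ‖S (v i)‖ₑ ^ 2 ≤ ∑' j, ‖(star S) (c j)‖ₑ ^ 2 := by
  calc ∑' i, ‖S (v i)‖ₑ ^ 2 = ∑' i, ∑' j, ‖inner ℂ (v i) (star S (c j))‖ₑ ^ 2 := by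
        congr 1; ext i
        rw [enorm_sq_eq_tsum c]
        congr 1; ext j
        rw [ContinuousLinearMap.star_eq_adjoint, ContinuousLinearMap.adjoint_inner_right,
          ← inner_conj_symm, ← ofReal_norm, ← ofReal_norm, RCLike.norm_conj]
    _ = ∑' j, ∑' i, ‖inner ℂ (v i) (star S (c j))‖ₑ ^ 2 := ENNReal.tsum_comm
    _ ≤ _ := ENNReal.tsum_le_tsum fun j => tsum_enorm_inner_sq_le hv _

theorem tsum_basis_star {ι κ : Type*} (b : HilbertBasis ι ℂ H)
    (c : HilbertBasis κ ℂ H) (S : H →L[ℂ] H) :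
    ∑' i, ‖S (b i)‖ₑ ^ 2 = ∑' j, ‖(star S) (c j)‖ₑ ^ 2 := by
  refine le_antisymm (tsum_orthonormal_le b.orthonormal c S) ?_
  simpa using tsum_orthonormal_le c.orthonormal b (star S)

theorem ofReal_re_inner_star_mul (S : H →L[ℂ] H) (x : H) :
    ENNReal.ofReal (inner ℂ x ((star S * S) x)).re = ‖S x‖ₑ ^ 2 := by
  rw [op_mul_apply, ContinuousLinearMap.star_eq_adjoint, ContinuousLinearMap.adjoint_inner_right,
    inner_self_eq_norm_sq_to_K]
  simp [← Complex.ofReal_pow, ENNReal.ofReal_pow, ofReal_norm]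


theorem opTrace_star_mul {ι : Type*} (b : HilbertBasis ι ℂ H) (S : H →L[ℂ] H) :
    opTrace (star S * S) = ∑' i, ‖S (b i)‖ₑ ^ 2 := by
  obtain ⟨c, hc⟩ := (exists_hilbertBasis ℂ H).choose_spec
  unfold opTrace
  simp_rw [ofReal_re_inner_star_mul]
  rw [tsum_basis_star b b, ← tsum_basis_star c b]
  rw [hc]

theorem opTrace_eq {ι : Type*} (b : HilbertBasis ι ℂ H) {A : H →L[ℂ] H} (hA : 0 ≤ A) :
    opTrace A = ∑' i, ENNReal.ofReal (inner ℂ (b i) (A (b i))).re := by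
  obtain ⟨S, rfl⟩ := CStarAlgebra.nonneg_iff_eq_star_mul_self.1 hA
  simp_rw [ofReal_re_inner_star_mul]
  exact opTrace_star_mul b S

theorem tsum_orthonormal_le_opTrace {ι : Type*} {v : ι → H} (hv : Orthonormal ℂ v)
    (S : H →L[ℂ] H) : ∑' i, ‖S (v i)‖ₑ ^ 2 ≤ opTrace (star S * S) := by
  obtain ⟨w, c, hc⟩ := exists_hilbertBasis ℂ H
  rw [opTrace_star_mul c, tsum_basis_star c c]
  exact tsum_orthonormal_le hv c S

theorem norm_abs_apply (T : H →L[ℂ] H) (x : H) : ‖CFC.abs T x‖ = ‖T x‖ := by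
  have h1 := ofReal_re_inner_star_mul T x
  have h2 := ofReal_re_inner_star_mul (CFC.abs T) x
  rw [(IsSelfAdjoint.of_nonneg (CFC.abs_nonneg T)).star_eq, CFC.abs_mul_abs, h1] at h2
  have h3 : ‖T x‖ₑ = ‖CFC.abs T x‖ₑ := by
    exact (ENNReal.pow_right_strictMono two_ne_zero).injective h2
  rw [← toReal_enorm, ← toReal_enorm, h3]

theorem polar_aux (T : H →L[ℂ] H) :
    (∃ U : H →L[ℂ] H, (U * CFC.abs T = T ∧ ∀ x, T x = 0 → U x = 0) ∧ ‖U‖ ≤ 1) ∧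
    ∀ U V : H →L[ℂ] H, (U * CFC.abs T = T ∧ ∀ x, T x = 0 → U x = 0) →
      (V * CFC.abs T = T ∧ ∀ x, T x = 0 → V x = 0) → U = V := by
  set B := CFC.abs T with hB
  have hBs : IsSelfAdjoint B := IsSelfAdjoint.of_nonneg (CFC.abs_nonneg T)
  set K : Submodule ℂ H := (LinearMap.range (B : H →ₗ[ℂ] H)).topologicalClosure with hK
  have hKc : IsClosed (K : Set H) := Submodule.isClosed_topologicalClosure _
  have : CompleteSpace K := hKc.completeSpace_coe
  have hmem : ∀ x, B x ∈ K := fun x => Submodule.le_topologicalClosure _ ⟨x, rfl⟩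
  have hperp : ∀ x, x ∈ Kᗮ → T x = 0 := by
    intro x hx
    have h1 : B x = 0 := by
      have h2 := hx (B (B x)) (hmem _)
      have h3 := hBs.isSymmetric (B x) x
      rw [← inner_self_eq_zero (𝕜 := ℂ)]
      exact h3.symm.trans h2
    rw [← norm_eq_zero, ← norm_abs_apply, ← hB, h1, norm_zero]
  have hperp' : ∀ x, T x = 0 → x ∈ Kᗮ := by
    intro x hx
    have h1 : B x = 0 := by rw [← norm_eq_zero, hB, norm_abs_apply, hx, norm_zero]
    rw [hK, Submodule.orthogonal_closure]
    rintro _ ⟨y, rfl⟩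
    have h3 := hBs.isSymmetric y x
    refine h3.trans ?_
    change inner ℂ y (B x) = 0
    rw [h1, inner_zero_right]
  let e : H →ₗ[ℂ] K := (B : H →ₗ[ℂ] H).codRestrict K hmem
  have hd : DenseRange e := by
    intro y
    rw [closure_subtype]
    have hy := y.2
    have : (Subtype.val '' Set.range e : Set H) = (LinearMap.range (B : H →ₗ[ℂ] H) : Set H) := by
      ext z; constructor
      · rintro ⟨_, ⟨x, rfl⟩, rfl⟩; exact ⟨x, rfl⟩
      · rintro ⟨x, rfl⟩; exact ⟨_, ⟨x, rfl⟩, rfl⟩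
    rw [this]
    exact hy
  have hn : ∀ x, ‖(T : H →ₗ[ℂ] H) x‖ ≤ 1 * ‖e x‖ :=
    fun x => by rw [one_mul]; exact (norm_abs_apply T x).symm.le
  refine ⟨⟨((T : H →ₗ[ℂ] H).extendOfNorm e).comp K.orthogonalProjectionOnto, ⟨?_, ?_⟩, ?_⟩, ?_⟩
  · ext x
    have : K.orthogonalProjectionOnto (B x) = e x :=
      Submodule.orthogonalProjectionOnto_mem_subspace_eq_self (K := K) (e x)
    change (T : H →ₗ[ℂ] H).extendOfNorm e (K.orthogonalProjectionOnto (B x)) = T x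
    rw [this, LinearMap.extendOfNorm_eq hd ⟨1, hn⟩]
    rfl
  · intro x hx
    have : K.orthogonalProjectionOnto x = 0 :=
      Submodule.orthogonalProjectionOnto_apply_of_mem_orthogonal (hperp' x hx)
    change (T : H →ₗ[ℂ] H).extendOfNorm e (K.orthogonalProjectionOnto x) = 0
    rw [this, map_zero]
  · refine ContinuousLinearMap.opNorm_le_bound _ zero_le_one fun x => ?_
    refine (LinearMap.norm_extendOfNorm_apply_le hd 1 hn _).trans ?_
    rw [one_mul, one_mul]
    exact K.norm_orthogonalProjectionOnto_apply_le x
  · intro U V hU hV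
    ext x
    have h1 : ∀ y ∈ K, U y = V y := by
      have hcl : IsClosed {y : H | U y = V y} := isClosed_eq U.continuous V.continuous
      intro y hy
      refine hcl.closure_subset_iff.2 ?_ hy
      rintro _ ⟨z, rfl⟩
      change (U * B) z = (V * B) z
      rw [hU.1, hV.1]
    have h2 : x - K.orthogonalProjectionOnto x ∈ Kᗮ :=
      Submodule.sub_starProjection_mem_orthogonal x
    have h3 := hperp _ h2
    have h4 : x = (K.orthogonalProjectionOnto x : H) + (x - K.orthogonalProjectionOnto x) := by abel
    rw [h4, map_add, map_add, hU.2 _ h3, hV.2 _ h3, h1 _ (K.orthogonalProjectionOnto x).2]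

theorem rpow_eq_star_mul {B : H →L[ℂ] H} (hB : 0 ≤ B) {r : ℝ} (hr : 0 ≤ r) :
    B ^ r = star (B ^ (r / 2)) * B ^ (r / 2) := by
  have h : IsSelfAdjoint (B ^ (r / 2)) := IsSelfAdjoint.of_nonneg CFC.rpow_nonneg
  rw [h.star_eq, ← pow_two, ← CFC.rpow_natCast _ 2 CFC.rpow_nonneg,
    CFC.rpow_rpow_of_exponent_nonneg B _ _ (by positivity) (by positivity)]
  congr 1
  push_cast; ring

theorem rpow_star_mul_self (T : H →L[ℂ] H) {p : ℝ} (hp : 0 ≤ p) :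
    (star T * T) ^ (p / 2) = CFC.abs T ^ p := by
  rw [CFC.abs, CFC.sqrt_eq_rpow, CFC.rpow_rpow_of_exponent_nonneg _ _ _ (by positivity) hp
    (star_mul_self_nonneg T)]
  congr 1
  ring

theorem re_inner_mono {A B : H →L[ℂ] H} (h : A ≤ B) (w : H) :
    (inner ℂ w (A w)).re ≤ (inner ℂ w (B w)).re := by
  have h1 := (ContinuousLinearMap.le_def _ _).1 h
  have h2 := h1.re_inner_nonneg_right w
  simp only [sub_apply, inner_sub_right, map_sub, sub_nonneg] at h2
  exact h2

theorem inner_rpow_le {B : H →L[ℂ] H} (hB : 0 ≤ B) {p : ℝ} (hp : 1 ≤ p) {w : H} (hw : ‖w‖ ≤ 1) :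
    (inner ℂ w (B w)).re ^ p ≤ (inner ℂ w ((B ^ p) w)).re := by
  set t := (inner ℂ w (B w)).re with ht
  have ht0 : 0 ≤ t := by simpa using re_inner_mono hB w
  have hp0 : 0 < p := by linarith
  have htan : ∀ x : ℝ, 0 ≤ x → p * t ^ (p - 1) * x - (p - 1) * t ^ p ≤ x ^ p := by
    intro x hx
    rcases ht0.eq_or_lt with h0 | h0
    · rw [← h0, Real.zero_rpow hp0.ne']
      rcases hp.eq_or_lt with h1 | h1
      · simp [← h1]
      · rw [Real.zero_rpow (by linarith)]
        simpa using Real.rpow_nonneg hx p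
    · have hb := one_add_mul_self_le_rpow_one_add (s := x / t - 1) (by linarith [div_nonneg hx ht0]) hp
      rw [add_sub_cancel, Real.div_rpow hx ht0, le_div_iff₀ (by positivity)] at hb
      refine le_trans (le_of_eq ?_) hb
      rw [Real.rpow_sub_one h0.ne']
      field_simp
      ring
  have hle : (p * t ^ (p - 1)) • B - algebraMap ℝ (H →L[ℂ] H) ((p - 1) * t ^ p) ≤ B ^ p := by
    have hBs := IsSelfAdjoint.of_nonneg hB
    have h1 : cfc (fun x : ℝ => p * t ^ (p - 1) * x - (p - 1) * t ^ p) B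
        = (p * t ^ (p - 1)) • B - algebraMap ℝ (H →L[ℂ] H) ((p - 1) * t ^ p) := by
      rw [cfc_sub _ _ B, cfc_const_mul_id _ B, cfc_const _ B]
    rw [← h1, CFC.rpow_eq_cfc_real hB]
    have hcont : Continuous fun x : ℝ => x ^ p := Real.continuous_rpow_const hp0.le
    refine cfc_mono (fun x hx => htan x (spectrum_nonneg_of_nonneg hB hx)) ?_ hcont.continuousOn
    fun_prop
  have h2 := re_inner_mono hle w
  have h3 : (inner ℂ w (((p * t ^ (p - 1)) • B - algebraMap ℝ (H →L[ℂ] H) ((p - 1) * t ^ p)) w)).re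
      = p * t ^ (p - 1) * t - (p - 1) * t ^ p * ‖w‖ ^ 2 := by
    rw [Algebra.algebraMap_eq_smul_one]
    simp only [sub_apply, smul_apply, one_apply_eq_self, inner_sub_right, Complex.sub_re]
    rw [← Complex.coe_smul, ← Complex.coe_smul, inner_smul_right, inner_smul_right,
      inner_self_eq_norm_sq_to_K, Complex.re_ofReal_mul, Complex.re_ofReal_mul]
    simp [← Complex.ofReal_pow, ht]
  rw [h3] at h2
  have h4 : t ^ (p - 1) * t = t ^ p := by
    rcases ht0.eq_or_lt with h0 | h0
    · rw [← h0, mul_zero, Real.zero_rpow hp0.ne']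
    · rw [Real.rpow_sub_one h0.ne']; field_simp
  have h5 : ‖w‖ ^ 2 ≤ 1 := by
    have := norm_nonneg w; nlinarith
  have h6 : (p - 1) * t ^ p * ‖w‖ ^ 2 ≤ (p - 1) * t ^ p :=
    mul_le_of_le_one_right (mul_nonneg (by linarith) (by positivity)) h5
  have h7 : p * t ^ (p - 1) * t = p * t ^ p := by rw [mul_assoc, h4]
  rw [h7] at h2
  linarith

theorem norm_rpow_half_le {B : H →L[ℂ] H} (hB : 0 ≤ B) {p : ℝ} (hp : 1 ≤ p) {w : H}
    (hw : ‖w‖ ≤ 1) : (‖(B ^ (1 / 2 : ℝ)) w‖ₑ ^ 2) ^ p ≤ ‖(B ^ (p / 2)) w‖ₑ ^ 2 := by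
  rw [← ofReal_re_inner_star_mul, ← ofReal_re_inner_star_mul, ← rpow_eq_star_mul hB zero_le_one,
    ← rpow_eq_star_mul hB (r := p) (by positivity), CFC.rpow_one B,
    ENNReal.ofReal_rpow_of_nonneg (by simpa using re_inner_mono hB w) (by positivity)]
  exact ENNReal.ofReal_le_ofReal (inner_rpow_le hB hp hw)

theorem tsum_inner_le {ι : Type*} {e f : ι → H} (he : Orthonormal ℂ e) (hf : Orthonormal ℂ f)
    {p : ℝ} (hp : 1 ≤ p) (T : H →L[ℂ] H) :
    ∑' i, ‖inner ℂ (f i) (T (e i))‖ₑ ^ p ≤ opTrace ((star T * T) ^ (p / 2)) := by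
  obtain ⟨⟨U, ⟨hU, -⟩, hU1⟩, -⟩ := polar_aux T
  have hp0 : 0 ≤ p := by linarith
  set B := CFC.abs T with hB
  have hB0 : 0 ≤ B := CFC.abs_nonneg T
  rw [rpow_star_mul_self T hp0, ← hB, rpow_eq_star_mul hB0 hp0]
  set S := B ^ (p / 2) with hS
  set R := B ^ (1 / 2 : ℝ) with hR
  have hRR : star R * R = B := by
    rw [hR, ← rpow_eq_star_mul hB0 zero_le_one, CFC.rpow_one B]
  have hUs : ‖star U‖ ≤ 1 := by rwa [norm_star]
  have hpt : ∀ i, ‖inner ℂ (f i) (T (e i))‖ₑ ^ p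
      ≤ (‖S (e i)‖ₑ ^ 2 + ‖(S * star U) (f i)‖ₑ ^ 2) / 2 := by
    intro i
    have h1 : inner ℂ (f i) (T (e i)) = inner ℂ (R (star U (f i))) (R (e i)) := by
      rw [← hU, ← hRR, ContinuousLinearMap.star_eq_adjoint, ContinuousLinearMap.star_eq_adjoint]
      simp only [op_mul_apply]
      rw [← ContinuousLinearMap.adjoint_inner_left, ContinuousLinearMap.adjoint_inner_right]
    have hn2 : ‖star U (f i)‖ ≤ 1 := by
      refine ((star U).le_opNorm _).trans ?_
      rw [hf.1 i, mul_one]; exact hUs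
    have h2 : (‖R (e i)‖ₑ ^ 2) ^ p ≤ ‖S (e i)‖ₑ ^ 2 := norm_rpow_half_le hB0 hp (he.1 i).le
    have h3 : (‖R (star U (f i))‖ₑ ^ 2) ^ p ≤ ‖(S * star U) (f i)‖ₑ ^ 2 :=
      norm_rpow_half_le hB0 hp hn2
    have h4 : ‖inner ℂ (f i) (T (e i))‖ₑ ≤ ‖R (star U (f i))‖ₑ * ‖R (e i)‖ₑ := by
      rw [h1, ← ofReal_norm, ← ofReal_norm, ← ofReal_norm, ← ENNReal.ofReal_mul (norm_nonneg _)]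
      exact ENNReal.ofReal_le_ofReal (norm_inner_le_norm _ _)
    have h5 : ∀ a b : ℝ≥0∞, a * b ≤ (a ^ 2 + b ^ 2) / 2 := by
      intro a b
      rw [ENNReal.le_div_iff_mul_le (by simp) (by simp)]
      by_cases ha : a = ⊤
      · simp [ha]
      by_cases hb : b = ⊤
      · simp [hb]
      lift a to ℝ≥0 using ha
      lift b to ℝ≥0 using hb
      norm_cast
      rw [← NNReal.coe_le_coe]
      push_cast
      nlinarith [sq_nonneg ((a : ℝ) - b)]
    calc _ ≤ (‖R (star U (f i))‖ₑ * ‖R (e i)‖ₑ) ^ p := ENNReal.rpow_le_rpow h4 hp0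
      _ = ‖R (e i)‖ₑ ^ p * ‖R (star U (f i))‖ₑ ^ p := by
        rw [ENNReal.mul_rpow_of_nonneg _ _ hp0, mul_comm]
      _ ≤ ((‖R (e i)‖ₑ ^ p) ^ 2 + (‖R (star U (f i))‖ₑ ^ p) ^ 2) / 2 := h5 _ _
      _ = ((‖R (e i)‖ₑ ^ 2) ^ p + (‖R (star U (f i))‖ₑ ^ 2) ^ p) / 2 := by
        simp only [← ENNReal.rpow_two, ← ENNReal.rpow_mul, mul_comm]
      _ ≤ _ := by gcongr
  have hA : ∑' i, ‖S (e i)‖ₑ ^ 2 ≤ opTrace (star S * S) := tsum_orthonormal_le_opTrace he S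
  have hC : ∑' i, ‖(S * star U) (f i)‖ₑ ^ 2 ≤ opTrace (star S * S) := by
    obtain ⟨w, c, hc⟩ := exists_hilbertBasis ℂ H
    refine (tsum_orthonormal_le hf c _).trans ?_
    rw [opTrace_star_mul c S]
    refine ENNReal.tsum_le_tsum fun j => ?_
    gcongr ?_ ^ 2
    have hSs : star S = S := (IsSelfAdjoint.of_nonneg CFC.rpow_nonneg).star_eq
    rw [star_mul, star_star, hSs, op_mul_apply, ← ofReal_norm, ← ofReal_norm]
    refine ENNReal.ofReal_le_ofReal ((U.le_opNorm _).trans ?_)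
    exact mul_le_of_le_one_left (norm_nonneg _) hU1
  calc _ ≤ ∑' i, (‖S (e i)‖ₑ ^ 2 + ‖(S * star U) (f i)‖ₑ ^ 2) / 2 := ENNReal.tsum_le_tsum hpt
    _ = (∑' i, ‖S (e i)‖ₑ ^ 2 + ∑' i, ‖(S * star U) (f i)‖ₑ ^ 2) / 2 := by
      simp_rw [div_eq_mul_inv]
      rw [ENNReal.tsum_mul_right, ENNReal.tsum_add]
    _ ≤ (opTrace (star S * S) + opTrace (star S * S)) / 2 := by gcongr
    _ = opTrace (star S * S) := by
      rw [← two_mul, mul_comm, mul_div_assoc, ENNReal.div_self (by simp) (by simp), mul_one]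

theorem exists_tsum_inner_eq {T : H →L[ℂ] H} (hT : IsCompactOperator T) {p : ℝ} (hp : 0 < p) :
    ∃ (ι : Type u) (e f : ι → H), Orthonormal ℂ e ∧ Orthonormal ℂ f ∧
      ∑' i, ‖inner ℂ (f i) (T (e i))‖ₑ ^ p = opTrace ((star T * T) ^ (p / 2)) := by
  have hA0 : 0 ≤ star T * T := star_mul_self_nonneg T
  have hAc : IsCompactOperator (star T * T) := hT.clm_comp (star T)
  obtain ⟨ι, b, c, hb⟩ := exists_eigenbasis (IsSelfAdjoint.of_nonneg hA0) hAc
  have hin : ∀ i j, inner ℂ (T (b i)) (T (b j)) = c j * inner ℂ (b i) (b j) := by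
    intro i j
    rw [← inner_smul_right, ← hb, op_mul_apply, ContinuousLinearMap.star_eq_adjoint,
      ContinuousLinearMap.adjoint_inner_right]
  have hc : ∀ i, c i = ((‖T (b i)‖ ^ 2 : ℝ) : ℂ) := by
    intro i
    have h := hin i i
    rw [inner_self_eq_norm_sq_to_K, inner_self_eq_norm_sq_to_K, b.orthonormal.1 i] at h
    simpa using h.symm
  have hs : opTrace ((star T * T) ^ (p / 2)) = ∑' i, ‖T (b i)‖ₑ ^ p := by
    rw [opTrace_eq b CFC.rpow_nonneg]
    congr 1; ext i
    rw [rpow_apply_eigenvector hA0 ((hb i).trans (by rw [hc i])) (by positivity), inner_smul_right,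
      inner_self_eq_norm_sq_to_K, b.orthonormal.1 i, ← ofReal_norm,
      ENNReal.ofReal_rpow_of_nonneg (norm_nonneg _) hp.le, ← Real.rpow_natCast,
      ← Real.rpow_mul (norm_nonneg _)]
    congr 1
    simp only [Complex.coe_algebraMap, Complex.ofReal_one, one_pow, mul_one, Complex.ofReal_re]
    congr 1
    push_cast; ring
  let s : Set ι := {i | T (b i) ≠ 0}
  refine ⟨s, fun i => b i, fun i => ((‖T (b i)‖⁻¹ : ℝ) : ℂ) • T (b i), ?_, ?_, ?_⟩
  · exact b.orthonormal.comp _ Subtype.val_injective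
  · refine ⟨fun i => ?_, fun i j hij => ?_⟩
    · have : ‖T (b i)‖ ≠ 0 := norm_ne_zero_iff.2 i.2
      rw [norm_smul]
      simp [this]
    · have : inner ℂ (b i) (b j) = 0 := b.orthonormal.2 fun h => hij (Subtype.ext h)
      simp [inner_smul_left, inner_smul_right, hin, this]
  · rw [hs, ← tsum_subtype_eq_of_support_subset (s := s)]
    · congr 1; ext i
      have h0 : ‖T (b i)‖ ≠ 0 := norm_ne_zero_iff.2 i.2
      congr 1
      rw [inner_smul_left, inner_self_eq_norm_sq_to_K, ← ofReal_norm, ← ofReal_norm]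
      congr 1
      simp
      field_simp
    · intro i hi
      simp only [Function.mem_support] at hi
      intro h
      apply hi
      simp [h, hp]

theorem opTrace_rpow_add_le {A B : H →L[ℂ] H} (hA : IsCompactOperator A) (hB : IsCompactOperator B)
    {p : ℝ} (hp : 1 ≤ p) :
    opTrace ((star (A + B) * (A + B)) ^ (p / 2)) ^ (1 / p)
      ≤ opTrace ((star A * A) ^ (p / 2)) ^ (1 / p) + opTrace ((star B * B) ^ (p / 2)) ^ (1 / p) := by
  have hp0 : 0 < p := by linarith
  obtain ⟨ι, e, f, he, hf, h⟩ := exists_tsum_inner_eq (T := A + B) (hA.add hB) hp0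
  rw [← h]
  let : MeasurableSpace ι := ⊤
  have hm := ENNReal.lintegral_Lp_add_le (μ := MeasureTheory.Measure.count)
    (f := fun i : ι => ‖inner ℂ (f i) (A (e i))‖ₑ) (g := fun i : ι => ‖inner ℂ (f i) (B (e i))‖ₑ)
    (Measurable.of_discrete.aemeasurable) (Measurable.of_discrete.aemeasurable) hp
  simp only [MeasureTheory.lintegral_count, Pi.add_apply] at hm
  refine le_trans ?_ (hm.trans ?_)
  · gcongr with i
    rw [add_apply, inner_add_right]
    exact enorm_add_le _ _
  · gcongr
    · exact tsum_inner_le he hf hp A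
    · exact tsum_inner_le he hf hp B

theorem opTrace_rpow_smul_le {A : H →L[ℂ] H} (hA : IsCompactOperator A) (c : ℂ)
    {p : ℝ} (hp : 1 ≤ p) :
    opTrace ((star (c • A) * (c • A)) ^ (p / 2)) ^ (1 / p)
      ≤ ‖c‖ₑ * opTrace ((star A * A) ^ (p / 2)) ^ (1 / p) := by
  have hp0 : 0 < p := by linarith
  obtain ⟨ι, e, f, he, hf, h⟩ := exists_tsum_inner_eq (T := c • A) (hA.smul c) hp0
  have h1 : opTrace ((star (c • A) * (c • A)) ^ (p / 2))
      ≤ ‖c‖ₑ ^ p * opTrace ((star A * A) ^ (p / 2)) := by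
    rw [← h]
    refine le_trans (le_of_eq ?_) (mul_le_mul_right (tsum_inner_le he hf hp A) _)
    rw [← ENNReal.tsum_mul_left]
    congr 1; ext i
    rw [← ENNReal.mul_rpow_of_nonneg _ _ hp0.le, smul_apply, inner_smul_right, enorm_mul]
  calc _ ≤ (‖c‖ₑ ^ p * opTrace ((star A * A) ^ (p / 2))) ^ (1 / p) := by gcongr
    _ = _ := by
      rw [ENNReal.mul_rpow_of_nonneg _ _ (by positivity), ← ENNReal.rpow_mul, mul_one_div_cancel hp0.ne',
        ENNReal.rpow_one]

theorem opTrace_zero : opTrace (0 : H →L[ℂ] H) = 0 := by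
  simp [opTrace]

theorem zero_rpow' {r : ℝ} (hr : 0 < r) : (0 : H →L[ℂ] H) ^ r = 0 :=
  CFC.zero_rpow hr.ne'

theorem eq_zero_of_opTrace {T : H →L[ℂ] H} {p : ℝ} (hp : 1 ≤ p)
    (h : opTrace ((star T * T) ^ (p / 2)) = 0) : T = 0 := by
  have hp0 : 0 < p := by linarith
  by_contra hne
  obtain ⟨x, hx⟩ : ∃ x, T x ≠ 0 := by
    by_contra! hcon
    exact hne (ContinuousLinearMap.ext hcon)
  have hx0 : x ≠ 0 := by rintro rfl; exact hx (map_zero T)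
  have key := tsum_inner_le (ι := Unit) (e := fun _ => ((‖x‖⁻¹ : ℝ) : ℂ) • x)
    (f := fun _ => ((‖T x‖⁻¹ : ℝ) : ℂ) • T x) ?_ ?_ hp T
  · rw [h] at key
    simp [hp0, hx, hx0] at key
    linarith
  · refine ⟨fun _ => ?_, fun i j hij => (hij rfl).elim⟩
    simp [norm_smul, hx0]
  · refine ⟨fun _ => ?_, fun i j hij => (hij rfl).elim⟩
    simp [norm_smul, hx]


/-- Polar decomposition: there is exactly one bounded operator `U` with `T = U |T|` that vanishes
on the kernel of `T`. -/
theorem existsUnique_polar (T : H →L[ℂ] H) :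
    ∃! U : H →L[ℂ] H, U * CFC.abs T = T ∧ ∀ x, T x = 0 → U x = 0 := by
  obtain ⟨⟨U, hU, -⟩, huniq⟩ := polar_aux T
  exact ⟨U, hU, fun V hV => huniq V U hV hU⟩

end SchattenAux

/-- `sign(T)`: the partial isometry in the polar decomposition `T = sign(T) |T|`, that is, the
unique operator `U` with `U |T| = T` that vanishes on the kernel of `T`. -/
noncomputable def opSign (T : H →L[ℂ] H) : H →L[ℂ] H :=
  (SchattenAux.existsUnique_polar T).choose

theorem opSign_spec (T : H →L[ℂ] H) :
    opSign T * CFC.abs T = T ∧ ∀ x, T x = 0 → opSign T x = 0 :=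
  (SchattenAux.existsUnique_polar T).choose_spec.1

theorem opSign_unique {T U : H →L[ℂ] H} (h : U * CFC.abs T = T) (h0 : ∀ x, T x = 0 → U x = 0) :
    U = opSign T :=
  (SchattenAux.existsUnique_polar T).choose_spec.2 U ⟨h, h0⟩

/-- The operator `sign(T) |T|^r`, the power being taken in the continuous functional calculus. -/
noncomputable def opMazur (r : ℝ) (T : H →L[ℂ] H) : H →L[ℂ] H :=
  opSign T * CFC.abs T ^ r

variable (H) in
/-- The Schatten ideal of compact operators `T` on `H` with `Trace((T^* T)^(p/2)) < ∞`, as a linear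
subspace of the bounded operators. -/
noncomputable def schattenIdeal (p : ℝ) [hp : Fact (1 ≤ p)] : Submodule ℂ (H →L[ℂ] H) where
  carrier := {T | IsCompactOperator T ∧ opTrace ((star T * T) ^ (p / 2)) < ⊤}
  zero_mem' := by
    have h1 := hp.out
    refine ⟨isCompactOperator_zero, ?_⟩
    rw [mul_zero, SchattenAux.zero_rpow' (by linarith), SchattenAux.opTrace_zero]
    exact ENNReal.zero_lt_top
  add_mem' := by
    rintro A B ⟨hA, hA1⟩ ⟨hB, hB1⟩
    have h0 : 0 < 1 / p := one_div_pos.2 (by linarith [hp.out])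
    refine ⟨hA.add hB, ?_⟩
    have h := SchattenAux.opTrace_rpow_add_le hA hB hp.out
    rw [← ENNReal.rpow_lt_top_iff_of_pos h0] at hA1 hB1 ⊢
    exact h.trans_lt (ENNReal.add_lt_top.2 ⟨hA1, hB1⟩)
  smul_mem' := by
    rintro c A ⟨hA, hA1⟩
    have h0 : 0 < 1 / p := one_div_pos.2 (by linarith [hp.out])
    refine ⟨hA.smul c, ?_⟩
    have h := SchattenAux.opTrace_rpow_smul_le hA c hp.out
    rw [← ENNReal.rpow_lt_top_iff_of_pos h0] at hA1 ⊢
    exact h.trans_lt (ENNReal.mul_lt_top enorm_lt_top hA1)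

variable (H) in
/-- The Schatten space `ℓ^p(H)`. It is a type of its own, so that it does not inherit the operator
norm of the bounded operators; its norm is the Schatten norm. -/
def SchattenSpace (p : ℝ) [Fact (1 ≤ p)] : Type u := schattenIdeal H p

namespace SchattenSpace

variable {p : ℝ} [hp : Fact (1 ≤ p)]

noncomputable instance : AddCommGroup (SchattenSpace H p) :=
  inferInstanceAs (AddCommGroup (schattenIdeal H p))

noncomputable instance : Module ℂ (SchattenSpace H p) :=
  inferInstanceAs (Module ℂ (schattenIdeal H p))

/-- The bounded operator underlying an element of `ℓ^p(H)`. -/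
def toOp (T : SchattenSpace H p) : H →L[ℂ] H := T.1

/-- The Schatten norm `Trace((T^* T)^(p/2))^(1/p)`. -/
noncomputable instance : Norm (SchattenSpace H p) :=
  ⟨fun T => (opTrace ((star T.toOp * T.toOp) ^ (p / 2)) ^ (1 / p)).toReal⟩

theorem norm_def (T : SchattenSpace H p) :
    ‖T‖ = (opTrace ((star T.toOp * T.toOp) ^ (p / 2)) ^ (1 / p)).toReal := rfl

theorem lt_top (T : SchattenSpace H p) :
    opTrace ((star T.toOp * T.toOp) ^ (p / 2)) ^ (1 / p) < ⊤ := by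
  rw [ENNReal.rpow_lt_top_iff_of_pos (one_div_pos.2 (by linarith [hp.out]))]
  exact T.2.2

theorem norm_smul_le_aux (c : ℂ) (T : SchattenSpace H p) : ‖c • T‖ ≤ ‖c‖ * ‖T‖ := by
  have h := SchattenAux.opTrace_rpow_smul_le T.2.1 c hp.out
  have h1 := ENNReal.toReal_mono (ENNReal.mul_lt_top enorm_lt_top T.lt_top).ne h
  rw [ENNReal.toReal_mul, toReal_enorm] at h1
  exact h1

theorem normCore : NormedSpace.Core ℂ (SchattenSpace H p) where
  norm_nonneg _ := ENNReal.toReal_nonneg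
  norm_smul c T := by
    refine le_antisymm (norm_smul_le_aux c T) ?_
    rcases eq_or_ne c 0 with rfl | hc
    · rw [norm_zero, zero_mul]
      exact ENNReal.toReal_nonneg
    · have h := norm_smul_le_aux c⁻¹ (c • T)
      rw [inv_smul_smul₀ hc, norm_inv] at h
      have h0 : 0 < ‖c‖ := norm_pos_iff.2 hc
      rwa [inv_mul_eq_div, le_div_iff₀ h0, mul_comm] at h
  norm_triangle S T := by
    have h := SchattenAux.opTrace_rpow_add_le S.2.1 T.2.1 hp.out
    have h1 := ENNReal.toReal_mono (ENNReal.add_lt_top.2 ⟨S.lt_top, T.lt_top⟩).ne h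
    rw [ENNReal.toReal_add S.lt_top.ne T.lt_top.ne] at h1
    exact h1
  norm_eq_zero_iff T := by
    have h0 : 0 < 1 / p := one_div_pos.2 (by linarith [hp.out])
    rw [norm_def, ENNReal.toReal_eq_zero_iff, or_iff_left T.lt_top.ne,
      ENNReal.rpow_eq_zero_iff_of_pos h0]
    constructor
    · intro h
      exact Subtype.ext (SchattenAux.eq_zero_of_opTrace hp.out h)
    · rintro rfl
      have : (0 : SchattenSpace H p).toOp = 0 := rfl
      rw [this, mul_zero, SchattenAux.zero_rpow' (by linarith [hp.out]), SchattenAux.opTrace_zero]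

noncomputable instance : NormedAddCommGroup (SchattenSpace H p) :=
  NormedAddCommGroup.ofCore normCore

noncomputable instance : NormedSpace ℂ (SchattenSpace H p) :=
  NormedSpace.ofCore normCore

end SchattenSpace

end Schatten

instance fact_one_le_ofReal {p : ℝ} [hp : Fact (1 ≤ p)] : Fact (1 ≤ ENNReal.ofReal p) :=
  ⟨by simpa using ENNReal.ofReal_le_ofReal hp.out⟩

/-- The Lebesgue-Bochner space `L^p(X, ℓ^p(H))` of classes of strongly measurable functions `f` with
values in `ℓ^p(H)` and `∫ Trace((f^* f)^(p/2)) dμ < ∞`, with its norm. -/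
abbrev SchattenLp {X : Type*} [MeasurableSpace X] (μ : MeasureTheory.Measure X) (H : Type*)
    [NormedAddCommGroup H] [InnerProductSpace ℂ H] [CompleteSpace H] (p : ℝ) [Fact (1 ≤ p)] :
    Type _ :=
  MeasureTheory.Lp (SchattenSpace H p) (ENNReal.ofReal p) μ

/-! ### Polar decomposition, powers and compactness. -/

section Operators

universe u

variable {H : Type u} [NormedAddCommGroup H] [InnerProductSpace ℂ H] [CompleteSpace H]

open SchattenAux

/-! Write `M` for the Mazur map. The core is an estimate without normalisation: for every `ε` there
is `K` with `‖M T - M S‖_q^q ≤ ε (‖T‖_p^p + ‖S‖_p^p) + K ‖T - S‖_p^p` for all `T`, `S` in `ℓ^p(H)`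
(`HasMazurModulus`, `hasMazurModulus`). It is linear in the powers of the norms, so it integrates
over `X`, and on unit spheres it is uniform continuity. Since `M` keeps `sign(T)` and multiplies
exponents, the Mazur map in the opposite direction is the inverse and obeys the same estimate.

Let `q ≥ 2`, `A = M T`, `B = M S`. Clarkson's inequality and the tangent inequality for `Tr |·|^q`
give strong monotonicity (`schattenPow_sub_le_pairing`): `‖A - B‖_q^q` is at most a constant times
`Re Tr (sign(A)|A|^(q-1) - sign(B)|B|^(q-1))^* (A - B)`. As `sign(A)|A|^(q-1) = sign(T)|T|^(p-p/q)`,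
that trace is the mixed energy `E_a` with `a = p/q`, where `E_a = Re Tr (sign(T)|T|^(p-a) -
sign(S)|S|^(p-a))^* (sign(T)|T|^a - sign(S)|S|^a)`. Singular value decompositions turn the energies
into double sums whose coefficients are dominated by a doubly substochastic matrix, and an
inequality between two positive numbers yields `E_a ≤ C E_1` (`exists_mixedEnergy_le`). Finally
`E_1` is a pairing with `T - S`, which Young's inequality controls (`exists_pairing_le`).

For general `q`, the map is factored through exponent `3q ≥ 3`. The remaining map, from exponent
`3q` to `q`, is `T ↦ T T^* T`, and Hölder's inequality makes it Lipschitz on bounded sets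
(`schattenPow_rpow_le_cube_sub`). -/

/-- `Trace((T^* T)^(p/2))`, the `p`-th power of the Schatten norm of `T`. -/
noncomputable def schattenPow (p : ℝ) (T : H →L[ℂ] H) : ℝ≥0∞ :=
  opTrace ((star T * T) ^ (p / 2))

theorem op_rpow_add {B : H →L[ℂ] H} {x y : ℝ} (hx : 0 < x) (hy : 0 < y) :
    B ^ (x + y) = B ^ x * B ^ y := by
  lift x to ℝ≥0 using hx.le
  lift y to ℝ≥0 using hy.le
  have hx' : 0 < x := by exact_mod_cast hx
  have hy' : 0 < y := by exact_mod_cast hy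
  rw [← NNReal.coe_add, ← CFC.nnrpow_eq_rpow hx', ← CFC.nnrpow_eq_rpow hy',
    ← CFC.nnrpow_eq_rpow (add_pos hx' hy'), CFC.nnrpow_add hx' hy']

theorem op_rpow_rpow {B : H →L[ℂ] H} (hB : 0 ≤ B) {x y : ℝ} (hx : 0 ≤ x) (hy : 0 ≤ y) :
    (B ^ x) ^ y = B ^ (x * y) :=
  CFC.rpow_rpow_of_exponent_nonneg B x y hx hy hB

theorem rpow_apply_eq_zero {B : H →L[ℂ] H} (hB : 0 ≤ B) {r : ℝ} (hr : 0 < r) {v : H}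
    (hv : B v = 0) : (B ^ r) v = 0 := by
  have := rpow_apply_eigenvector hB (t := 0) (v := v) (by simpa using hv) hr.le
  simpa [Real.zero_rpow hr.ne'] using this

theorem rpow_apply_eq_zero_iff {B : H →L[ℂ] H} (hB : 0 ≤ B) {r : ℝ} (hr : 0 < r) {v : H} :
    (B ^ r) v = 0 ↔ B v = 0 := by
  refine ⟨fun h => ?_, rpow_apply_eq_zero hB hr⟩
  have h1 := rpow_apply_eq_zero CFC.rpow_nonneg (inv_pos.2 hr) h
  rwa [op_rpow_rpow hB hr.le (inv_pos.2 hr).le, mul_inv_cancel₀ hr.ne', CFC.rpow_one B] at h1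

theorem abs_apply_eq_zero_iff (T : H →L[ℂ] H) {v : H} : CFC.abs T v = 0 ↔ T v = 0 := by
  rw [← norm_eq_zero, norm_abs_apply, norm_eq_zero]

theorem star_abs (T : H →L[ℂ] H) : star (CFC.abs T) = CFC.abs T :=
  (IsSelfAdjoint.of_nonneg (CFC.abs_nonneg T)).star_eq

/-- With `U = sign(T)`, the defect `v = U^* U |T| x - |T| x` lies in `ker |T|`, because `|T| U^* U
|T| = T^* T = |T|^2`. Hence `U v = 0` as well, so `v` is orthogonal to both of its terms and
vanishes. -/
theorem star_opSign_mul_opSign_mul_abs (T : H →L[ℂ] H) :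
    star (opSign T) * opSign T * CFC.abs T = CFC.abs T := by
  set U := opSign T with hU
  set B := CFC.abs T with hB
  have hBs : star B = B := star_abs T
  have h1 : U * B = T := (opSign_spec T).1
  have h2 : B * (star U * U * B) = B * B := by
    have : B * (star U * U * B) = star (U * B) * (U * B) := by
      rw [star_mul, hBs]; simp only [mul_assoc]
    rw [this, h1, hB, CFC.abs_mul_abs]
  ext x
  set v := (star U * U * B) x - B x with hv
  have hBv : B v = 0 := by
    have := congrArg (fun A : H →L[ℂ] H => A x) h2
    simp only [op_mul_apply] at this
    rw [hv, map_sub, sub_eq_zero, op_mul_apply, op_mul_apply, this]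
  have hUv : U v = 0 := (opSign_spec T).2 v ((abs_apply_eq_zero_iff T).1 hBv)
  have hvv : inner ℂ v v = 0 := by
    have e1 : inner ℂ v ((star U * U * B) x) = 0 := by
      rw [op_mul_apply, op_mul_apply, ContinuousLinearMap.star_eq_adjoint,
        ContinuousLinearMap.adjoint_inner_right, hUv, inner_zero_left]
    have e2 : inner ℂ v (B x) = 0 := by
      rw [← hBs, ContinuousLinearMap.star_eq_adjoint,
        ContinuousLinearMap.adjoint_inner_right, hBv, inner_zero_left]
    conv_lhs => rw [hv]
    rw [← hv, inner_sub_right, e1, e2, sub_zero]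
  exact sub_eq_zero.1 (inner_self_eq_zero.1 hvv)

theorem star_opSign_mul_opSign_mul_rpow (T : H →L[ℂ] H) {r : ℝ} (hr : 0 < r) :
    star (opSign T) * opSign T * CFC.abs T ^ r = CFC.abs T ^ r := by
  have h := congrArg star (star_opSign_mul_opSign_mul_abs T)
  rw [star_mul, star_abs, star_mul, star_star] at h
  have h1 : CFC.abs T ^ r * (star (opSign T) * opSign T) = CFC.abs T ^ r := by
    ext x
    -- `|T|^r` vanishes wherever `|T|` does, so the adjoint identity passes from `|T|` to `|T|^r`.
    have h2 : CFC.abs T ((star (opSign T) * opSign T) x - x) = 0 := by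
      rw [map_sub, ← op_mul_apply, h, sub_self]
    have h3 := rpow_apply_eq_zero (CFC.abs_nonneg T) hr h2
    rw [map_sub, sub_eq_zero] at h3
    exact h3
  have h4 := congrArg star h1
  have h5 : star (CFC.abs T ^ r) = CFC.abs T ^ r :=
    (IsSelfAdjoint.of_nonneg CFC.rpow_nonneg).star_eq
  rwa [star_mul, h5, star_mul, star_star] at h4

theorem star_opMazur_mul_opMazur (T : H →L[ℂ] H) {r : ℝ} (hr : 0 < r) :
    star (opMazur r T) * opMazur r T = CFC.abs T ^ r * CFC.abs T ^ r := by
  have h5 : star (CFC.abs T ^ r) = CFC.abs T ^ r :=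
    (IsSelfAdjoint.of_nonneg CFC.rpow_nonneg).star_eq
  rw [opMazur, star_mul, h5, mul_assoc, ← mul_assoc (star _), star_opSign_mul_opSign_mul_rpow T hr]

theorem abs_opMazur (T : H →L[ℂ] H) {r : ℝ} (hr : 0 < r) :
    CFC.abs (opMazur r T) = CFC.abs T ^ r := by
  rw [CFC.abs, star_opMazur_mul_opMazur T hr, CFC.sqrt_mul_self _ CFC.rpow_nonneg]

theorem opMazur_apply_eq_zero_iff (T : H →L[ℂ] H) {r : ℝ} (hr : 0 < r) {v : H} :
    opMazur r T v = 0 ↔ T v = 0 := by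
  rw [← abs_apply_eq_zero_iff, abs_opMazur T hr, rpow_apply_eq_zero_iff (CFC.abs_nonneg T) hr,
    abs_apply_eq_zero_iff]

theorem opSign_opMazur (T : H →L[ℂ] H) {r : ℝ} (hr : 0 < r) :
    opSign (opMazur r T) = opSign T := by
  refine (opSign_unique ?_ fun x hx => ?_).symm
  · rw [abs_opMazur T hr, opMazur]
  · exact (opSign_spec T).2 x ((opMazur_apply_eq_zero_iff T hr).1 hx)

theorem opMazur_opMazur (T : H →L[ℂ] H) {r s : ℝ} (hr : 0 < r) (hs : 0 < s) :
    opMazur s (opMazur r T) = opMazur (r * s) T := by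
  rw [opMazur, opSign_opMazur T hr, abs_opMazur T hr, op_rpow_rpow (CFC.abs_nonneg T) hr.le hs.le]
  rfl

theorem opMazur_one (T : H →L[ℂ] H) : opMazur 1 T = T := by
  rw [opMazur, CFC.rpow_one _ (CFC.abs_nonneg T), (opSign_spec T).1]

/-- At exponent three the Mazur map is a polynomial in `T` and `T^*`, so differences can be
telescoped and estimated by Hölder's inequality. -/
theorem opMazur_three (T : H →L[ℂ] H) : opMazur 3 T = T * star T * T := by
  have h : CFC.abs T ^ (3 : ℝ) = CFC.abs T * (CFC.abs T * CFC.abs T) := by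
    rw [show (3 : ℝ) = 1 + (1 + 1) by norm_num, op_rpow_add one_pos (by norm_num),
      op_rpow_add one_pos one_pos, CFC.rpow_one _ (CFC.abs_nonneg T)]
  rw [opMazur, h, ← mul_assoc, (opSign_spec T).1, CFC.abs_mul_abs, mul_assoc]

theorem schattenPow_eq_abs (T : H →L[ℂ] H) {p : ℝ} (hp : 0 ≤ p) :
    schattenPow p T = opTrace (CFC.abs T ^ p) := by
  rw [schattenPow, rpow_star_mul_self T hp]

theorem schattenPow_opMazur (T : H →L[ℂ] H) {r q : ℝ} (hr : 0 < r) (hq : 0 ≤ q) :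
    schattenPow q (opMazur r T) = schattenPow (r * q) T := by
  rw [schattenPow_eq_abs _ hq, abs_opMazur T hr, op_rpow_rpow (CFC.abs_nonneg T) hr.le hq,
    schattenPow_eq_abs _ (by positivity)]

theorem IsCompactOperator.mul_left_op {A : H →L[ℂ] H} (hA : IsCompactOperator A) (B : H →L[ℂ] H) :
    IsCompactOperator (B * A : H →L[ℂ] H) :=
  hA.clm_comp B

theorem IsCompactOperator.mul_right_op {A : H →L[ℂ] H} (hA : IsCompactOperator A)
    (B : H →L[ℂ] H) : IsCompactOperator (A * B : H →L[ℂ] H) :=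
  hA.comp_clm B

/-- Uses `|T| = sign(T)^* T`. -/
theorem isCompactOperator_abs {T : H →L[ℂ] H} (hT : IsCompactOperator T) :
    IsCompactOperator (CFC.abs T : H →L[ℂ] H) := by
  rw [← star_opSign_mul_opSign_mul_abs T, mul_assoc, (opSign_spec T).1]
  exact hT.mul_left_op _

theorem isCompactOperator_star {T : H →L[ℂ] H} (hT : IsCompactOperator T) :
    IsCompactOperator (star T : H →L[ℂ] H) := by
  rw [← (opSign_spec T).1, star_mul, star_abs]
  exact (isCompactOperator_abs hT).mul_right_op _

/-- `B^r` is the norm limit of the compact operators `B k_ε(B)` with `k_ε(x) = x^r / max x ε`: the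
functions `x k_ε(x)` and `x^r` agree for `x ≥ ε` and differ by at most `ε^r` on `[0, ε]`. -/
theorem isCompactOperator_rpow {B : H →L[ℂ] H} (hB : 0 ≤ B) (hc : IsCompactOperator B) {r : ℝ}
    (hr : 0 < r) : IsCompactOperator (B ^ r : H →L[ℂ] H) := by
  have hcont : Continuous fun x : ℝ => x ^ r := Real.continuous_rpow_const hr.le
  have key : ∀ n : ℕ, ∃ A : H →L[ℂ] H, IsCompactOperator A ∧
      ‖A - B ^ r‖ ≤ (1 / ((n : ℝ) + 1)) ^ r := by
    intro n
    have hε : (0 : ℝ) < 1 / ((n : ℝ) + 1) := by positivity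
    set ε := 1 / ((n : ℝ) + 1)
    have hmax : ∀ x : ℝ, 0 < max x ε := fun x => lt_max_of_lt_right hε
    have hk : Continuous fun x : ℝ => x ^ r / max x ε :=
      hcont.div (by fun_prop) fun x => (hmax x).ne'
    refine ⟨B * cfc (fun x : ℝ => x ^ r / max x ε) B, hc.mul_right_op _, ?_⟩
    have h1 : B * cfc (fun x : ℝ => x ^ r / max x ε) B - B ^ r
        = cfc (fun x : ℝ => x * (x ^ r / max x ε) - x ^ r) B := by
      rw [cfc_sub (fun x : ℝ => x * (x ^ r / max x ε)) _ B
          (continuous_id.mul hk).continuousOn hcont.continuousOn,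
        cfc_mul (fun x : ℝ => x) _ B continuousOn_id hk.continuousOn, cfc_id' ℝ B,
        ← CFC.rpow_eq_cfc_real hB]
    rw [h1]
    refine norm_cfc_le (by positivity) fun x hx => ?_
    have hx0 : 0 ≤ x := spectrum_nonneg_of_nonneg hB hx
    rcases le_total ε x with hxe | hxe
    · rw [max_eq_left hxe, mul_div_cancel₀ _ (hε.trans_le hxe).ne', sub_self, norm_zero]
      positivity
    · rw [max_eq_right hxe, Real.norm_eq_abs, abs_sub_comm, abs_of_nonneg]
      · have h2 : 0 ≤ x * (x ^ r / ε) := by positivity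
        have h3 : x ^ r ≤ ε ^ r := Real.rpow_le_rpow hx0 hxe hr.le
        linarith
      · have h2 : x * (x ^ r / ε) = (x / ε) * x ^ r := by ring
        rw [h2, sub_nonneg]
        exact mul_le_of_le_one_left (by positivity) ((div_le_one hε).2 hxe)
  choose A hA hAn using key
  refine isCompactOperator_of_tendsto (l := Filter.atTop) (F := A) ?_ (.of_forall hA)
  rw [tendsto_iff_norm_sub_tendsto_zero]
  refine squeeze_zero (fun _ => norm_nonneg _) hAn ?_
  have := (tendsto_one_div_add_atTop_nhds_zero_nat (𝕜 := ℝ)).rpow_const (Or.inr hr.le)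
  rwa [Real.zero_rpow hr.ne'] at this

theorem isCompactOperator_opMazur {T : H →L[ℂ] H} (hT : IsCompactOperator T) {r : ℝ}
    (hr : 0 < r) : IsCompactOperator (opMazur r T) :=
  (isCompactOperator_rpow (CFC.abs_nonneg T) (isCompactOperator_abs hT) hr).mul_left_op _

end Operators
-- Singular value decompositions.
section SingularValues

universe u

variable {H : Type u} [NormedAddCommGroup H] [InnerProductSpace ℂ H] [CompleteSpace H]

open SchattenAux

/-- A singular value decomposition `T = ∑ tᵢ ⟨eᵢ, ·⟩ fᵢ`, together with the series for the operators
`sign(T) |T|^r` and for the traces of `|T|^p` that it gives. -/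
structure IsSingularSystem {ι : Type*} (T : H →L[ℂ] H) (e f : ι → H) (t : ι → ℝ) : Prop where
  left : Orthonormal ℂ e
  right : Orthonormal ℂ f
  pos : ∀ i, 0 < t i
  apply_left : ∀ r : ℝ, 0 < r → ∀ i, opMazur r T (e i) = ((t i ^ r : ℝ) : ℂ) • f i
  hasSum : ∀ r : ℝ, 0 < r → ∀ x,
    HasSum (fun i => (inner ℂ (e i) x * ((t i ^ r : ℝ) : ℂ)) • f i) (opMazur r T x)
  pow : ∀ p : ℝ, 0 < p → schattenPow p T = ∑' i, ENNReal.ofReal (t i ^ p)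

theorem exists_isSingularSystem {T : H →L[ℂ] H} (hT : IsCompactOperator T) :
    ∃ (ι : Type u) (e f : ι → H) (t : ι → ℝ), IsSingularSystem T e f t := by
  have hA0 : 0 ≤ star T * T := star_mul_self_nonneg T
  have hAc : IsCompactOperator (star T * T) := hT.clm_comp (star T)
  obtain ⟨ι, b, c, hb⟩ := exists_eigenbasis (IsSelfAdjoint.of_nonneg hA0) hAc
  have hc : ∀ i, c i = ((‖T (b i)‖ ^ 2 : ℝ) : ℂ) := by
    intro i
    have h : inner ℂ (T (b i)) (T (b i)) = c i * inner ℂ (b i) (b i) := by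
      rw [← inner_smul_right, ← hb, op_mul_apply, ContinuousLinearMap.star_eq_adjoint,
        ContinuousLinearMap.adjoint_inner_right]
    rw [inner_self_eq_norm_sq_to_K, inner_self_eq_norm_sq_to_K, b.orthonormal.1 i] at h
    simpa using h.symm
  set t : ι → ℝ := fun i => ‖T (b i)‖ with ht
  have ht0 : ∀ i, 0 ≤ t i := fun i => norm_nonneg _
  have habs : ∀ i, CFC.abs T (b i) = ((t i : ℝ) : ℂ) • b i := by
    intro i
    rw [CFC.abs, CFC.sqrt_eq_rpow,
      rpow_apply_eigenvector hA0 ((hb i).trans (by rw [hc i])) (by positivity)]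
    congr 2
    rw [← Real.sqrt_eq_rpow, Real.sqrt_sq (norm_nonneg _)]
  have hrpow : ∀ r : ℝ, 0 < r → ∀ i, (CFC.abs T ^ r) (b i) = ((t i ^ r : ℝ) : ℂ) • b i :=
    fun r hr i => rpow_apply_eigenvector (CFC.abs_nonneg T) (habs i) hr.le
  set g : ι → H := fun i => opSign T (b i) with hg
  have hM : ∀ r : ℝ, 0 < r → ∀ i, opMazur r T (b i) = ((t i ^ r : ℝ) : ℂ) • g i := by
    intro r hr i
    rw [opMazur, op_mul_apply, hrpow r hr i, map_smul]
  -- Indices with `t i = 0` are dropped: there `opSign T (b i) = 0`, which would spoil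
  -- orthonormality of the `g i`. The series lose nothing, since the exponents are positive.
  let s : Set ι := {i | t i ≠ 0}
  have hpos : ∀ i : s, 0 < t i := fun i => lt_of_le_of_ne (ht0 _) (Ne.symm i.2)
  have hUU : ∀ i : s, star (opSign T) (g i) = b i := by
    intro i
    have h := congrArg (fun A : H →L[ℂ] H => A (b i)) (star_opSign_mul_opSign_mul_abs T)
    simp only [op_mul_apply] at h
    rw [habs, map_smul, map_smul] at h
    exact smul_right_injective H (Complex.ofReal_ne_zero.2 i.2) h
  have hin : ∀ i j : s, inner ℂ (g i) (g j) = inner ℂ (b i) (b j) := by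
    intro i j
    rw [← hUU j, ContinuousLinearMap.star_eq_adjoint, ContinuousLinearMap.adjoint_inner_right]
  have hbs : Orthonormal ℂ fun i : s => b i := b.orthonormal.comp _ Subtype.val_injective
  refine ⟨s, fun i => b i, fun i => g i, fun i => t i, hbs, ?_, hpos, fun r hr i => hM r hr i,
    fun r hr x => ?_, fun p hp => ?_⟩
  · classical
    rw [orthonormal_iff_ite] at hbs ⊢
    intro i j
    rw [hin]; exact hbs i j
  · have h1 := (b.hasSum_repr x).mapL (opMazur r T)
    simp only [map_smul, hM r hr, smul_smul, HilbertBasis.repr_apply_apply] at h1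
    refine (hasSum_subtype_iff_of_support_subset (s := s) ?_).2 h1
    intro i hi h0
    apply hi
    have : t i = 0 := h0
    simp [this, Real.zero_rpow hr.ne']
  · rw [schattenPow_eq_abs T hp.le, opTrace_eq b CFC.rpow_nonneg,
      ← tsum_subtype_eq_of_support_subset (s := s)]
    · congr 1; ext i
      rw [hrpow p hp, inner_smul_right, inner_self_eq_norm_sq_to_K, b.orthonormal.1]
      simp
    · intro i hi h0
      have : t i = 0 := h0
      apply hi
      simp [hrpow p hp, this, Real.zero_rpow hp.ne']

namespace IsSingularSystem

variable {ι : Type*} {T : H →L[ℂ] H} {e f : ι → H} {t : ι → ℝ}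

theorem hasSum_inner (h : IsSingularSystem T e f t) {r : ℝ} (hr : 0 < r) (x y : H) :
    HasSum (fun i => t i ^ r * (inner ℂ y (f i) * inner ℂ (e i) x).re)
      (inner ℂ y (opMazur r T x)).re := by
  have h1 := Complex.hasSum_re ((h.hasSum r hr x).mapL (innerSL ℂ y))
  simp only [innerSL_apply_apply, inner_smul_right] at h1
  convert h1 using 2 with i
  rw [← Complex.re_ofReal_mul]
  congr 1; ring

theorem summable (h : IsSingularSystem T e f t) {p : ℝ} (hp : 0 < p) (hT : schattenPow p T ≠ ⊤) :
    Summable fun i => t i ^ p := by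
  rw [h.pow p hp] at hT
  have := ENNReal.summable_toReal hT
  exact this.congr fun i => ENNReal.toReal_ofReal (Real.rpow_nonneg (h.pos i).le p)

theorem toReal_schattenPow (h : IsSingularSystem T e f t) {p : ℝ} (hp : 0 < p) :
    (schattenPow p T).toReal = ∑' i, t i ^ p := by
  rw [h.pow p hp, ENNReal.tsum_toReal_eq fun _ => ENNReal.ofReal_ne_top]
  exact tsum_congr fun i => ENNReal.toReal_ofReal (Real.rpow_nonneg (h.pos i).le p)

theorem inner_opMazur_left (h : IsSingularSystem T e f t) {r : ℝ} (hr : 0 < r) (i : ι) :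
    (inner ℂ (f i) (opMazur r T (e i))).re = t i ^ r := by
  rw [h.apply_left r hr, inner_smul_right, inner_self_eq_norm_sq_to_K, h.right.1 i]
  simp

/-- The same orthonormal families serve every power, so pairings for the image under the Mazur map
can be read as pairings for `T`. -/
theorem map_opMazur (h : IsSingularSystem T e f t) {r : ℝ} (hr : 0 < r) :
    IsSingularSystem (opMazur r T) e f fun i => t i ^ r where
  left := h.left
  right := h.right
  pos i := Real.rpow_pos_of_pos (h.pos i) r
  apply_left s hs i := by
    rw [opMazur_opMazur T hr hs, h.apply_left _ (mul_pos hr hs), Real.rpow_mul (h.pos i).le]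
  hasSum s hs x := by
    rw [opMazur_opMazur T hr hs]
    have := h.hasSum _ (mul_pos hr hs) x
    simpa only [Real.rpow_mul (h.pos _).le] using this
  pow p hp := by
    rw [schattenPow_opMazur T hr hp.le, h.pow _ (mul_pos hr hp)]
    simp only [Real.rpow_mul (h.pos _).le]

end IsSingularSystem

/-- The sum of the `|⟨fᵢ, T eᵢ⟩|^p` over two orthonormal families is at most `Trace(|T|^p)`. -/
theorem summable_inner_rpow {ι : Type*} {e f : ι → H} (he : Orthonormal ℂ e) (hf : Orthonormal ℂ f)
    {p : ℝ} (hp : 1 ≤ p) {T : H →L[ℂ] H} (hT : schattenPow p T ≠ ⊤) :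
    (Summable fun i => ‖inner ℂ (f i) (T (e i))‖ ^ p) ∧
      ∑' i, ‖inner ℂ (f i) (T (e i))‖ ^ p ≤ (schattenPow p T).toReal := by
  have h := tsum_inner_le he hf hp T
  have h1 : ∀ i, ‖inner ℂ (f i) (T (e i))‖ ^ p = (‖inner ℂ (f i) (T (e i))‖ₑ ^ p).toReal := by
    intro i; rw [← ENNReal.toReal_rpow, toReal_enorm]
  have h2 : ∑' i, ‖inner ℂ (f i) (T (e i))‖ₑ ^ p ≠ ⊤ := ne_top_of_le_ne_top hT h
  simp_rw [h1]
  refine ⟨ENNReal.summable_toReal h2, ?_⟩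
  rw [← ENNReal.tsum_toReal_eq fun i => ENNReal.ne_top_of_tsum_ne_top h2 i]
  exact ENNReal.toReal_mono hT h

end SingularValues
-- Clarkson's inequality for exponents at least two.
section Clarkson

universe u

variable {H : Type u} [NormedAddCommGroup H] [InnerProductSpace ℂ H] [CompleteSpace H]

open SchattenAux

/-- Douglas factorisation: `R x ↦ J x` is a well-defined contraction on the range of `R`; extend it
to the closure by continuity and by zero to the orthogonal complement. -/
theorem exists_contraction_factor {E : Type*} [NormedAddCommGroup E] [NormedSpace ℂ E]
    [CompleteSpace E] (J : H →L[ℂ] E) (R : H →L[ℂ] H) (h : ∀ x, ‖J x‖ ≤ ‖R x‖) :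
    ∃ W : H →L[ℂ] E, ‖W‖ ≤ 1 ∧ ∀ x, W (R x) = J x := by
  set K : Submodule ℂ H := (LinearMap.range (R : H →ₗ[ℂ] H)).topologicalClosure with hK
  have hKc : IsClosed (K : Set H) := Submodule.isClosed_topologicalClosure _
  have : CompleteSpace K := hKc.completeSpace_coe
  have hmem : ∀ x, R x ∈ K := fun x => Submodule.le_topologicalClosure _ ⟨x, rfl⟩
  let e : H →ₗ[ℂ] K := (R : H →ₗ[ℂ] H).codRestrict K hmem
  have hd : DenseRange e := by
    intro y
    rw [closure_subtype]
    have : (Subtype.val '' Set.range e : Set H) = (LinearMap.range (R : H →ₗ[ℂ] H) : Set H) := by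
      ext z; constructor
      · rintro ⟨_, ⟨x, rfl⟩, rfl⟩; exact ⟨x, rfl⟩
      · rintro ⟨x, rfl⟩; exact ⟨_, ⟨x, rfl⟩, rfl⟩
    rw [this]
    exact y.2
  have hn : ∀ x, ‖(J : H →ₗ[ℂ] E) x‖ ≤ 1 * ‖e x‖ := fun x => by rw [one_mul]; exact h x
  refine ⟨((J : H →ₗ[ℂ] E).extendOfNorm e).comp K.orthogonalProjectionOnto, ?_, fun x => ?_⟩
  · refine ContinuousLinearMap.opNorm_le_bound _ zero_le_one fun x => ?_
    refine (LinearMap.norm_extendOfNorm_apply_le hd 1 hn _).trans ?_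
    rw [one_mul, one_mul]
    exact K.norm_orthogonalProjectionOnto_apply_le x
  · have : K.orthogonalProjectionOnto (R x) = e x :=
      Submodule.orthogonalProjectionOnto_mem_subspace_eq_self (K := K) (e x)
    change (J : H →ₗ[ℂ] E).extendOfNorm e (K.orthogonalProjectionOnto (R x)) = J x
    rw [this, LinearMap.extendOfNorm_eq hd ⟨1, hn⟩]
    rfl

/-- The factorisation is applied to the column `x ↦ (A x, B x)` with values in the Hilbert sum of
two copies of `H`, so that `K^* K + L^* L ≤ 1` comes out jointly. -/
theorem exists_contraction_factor_pair (A B R : H →L[ℂ] H)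
    (h : ∀ x, ‖A x‖ ^ 2 + ‖B x‖ ^ 2 = ‖R x‖ ^ 2) :
    ∃ K L : H →L[ℂ] H, K * R = A ∧ L * R = B ∧ ∀ x, ‖K x‖ ^ 2 + ‖L x‖ ^ 2 ≤ ‖x‖ ^ 2 := by
  let Φ := WithLp.prodContinuousLinearEquiv 2 ℂ H H
  have hnorm : ∀ z : WithLp 2 (H × H), ‖z‖ ^ 2 = ‖(Φ z).1‖ ^ 2 + ‖(Φ z).2‖ ^ 2 :=
    fun z => WithLp.prod_norm_sq_eq_of_L2 z
  obtain ⟨W, hW, hWR⟩ := exists_contraction_factor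
    ((Φ.symm : H × H →L[ℂ] WithLp 2 (H × H)).comp (A.prod B)) R (fun x => by
      rw [← sq_le_sq₀ (norm_nonneg _) (norm_nonneg _), hnorm, ← h x]
      simp)
  refine ⟨(ContinuousLinearMap.fst ℂ H H).comp ((Φ : WithLp 2 (H × H) →L[ℂ] H × H).comp W),
    (ContinuousLinearMap.snd ℂ H H).comp ((Φ : WithLp 2 (H × H) →L[ℂ] H × H).comp W), ?_, ?_, ?_⟩
  · ext x; simp [hWR]
  · ext x; simp [hWR]
  · intro x
    have h1 : ‖W x‖ ≤ ‖x‖ := by simpa using W.le_of_opNorm_le hW x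
    calc _ = ‖W x‖ ^ 2 := (hnorm (W x)).symm
      _ ≤ _ := by gcongr

/-- For optimal families, `|⟨f, A e⟩|^q ≤ ⟨w, Z w⟩^(q/2)` with `w = K^* f`, and Jensen's inequality
bounds this by `⟨w, Z^(q/2) w⟩ = ‖Z^(q/4) K^* f‖^2`. Summing gives the Hilbert-Schmidt norm of
`Z^(q/4) K^*`, which equals that of its adjoint. -/
theorem schattenPow_le_of_factor {Z K A : H →L[ℂ] H} (hZ : 0 ≤ Z) (hA : IsCompactOperator A)
    (hKA : K * Z ^ (1 / 2 : ℝ) = A) (hK : ‖K‖ ≤ 1) {q : ℝ} (hq : 2 ≤ q) {κ : Type*}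
    (c : HilbertBasis κ ℂ H) :
    schattenPow q A ≤ ∑' j, ‖K ((Z ^ (q / 2 / 2)) (c j))‖ₑ ^ 2 := by
  obtain ⟨ι, e, f, he, hf, h⟩ := exists_tsum_inner_eq hA (p := q) (by linarith)
  rw [schattenPow, ← h]
  set R := Z ^ (1 / 2 : ℝ) with hR
  set V := Z ^ (q / 2 / 2) with hV
  have hRs : star R = R := (IsSelfAdjoint.of_nonneg CFC.rpow_nonneg).star_eq
  have hVs : star V = V := (IsSelfAdjoint.of_nonneg CFC.rpow_nonneg).star_eq
  have h1 : ∀ i, ‖inner ℂ (f i) (A (e i))‖ₑ ^ q ≤ ‖(V * star K) (f i)‖ₑ ^ 2 := by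
    intro i
    have hw : ‖star K (f i)‖ ≤ 1 := by
      refine ((star K).le_opNorm _).trans ?_
      rw [hf.1 i, mul_one, norm_star]; exact hK
    have h2 : inner ℂ (f i) (A (e i)) = inner ℂ (R (star K (f i))) (e i) := by
      rw [← hKA, op_mul_apply, ContinuousLinearMap.star_eq_adjoint]
      conv_rhs => rw [← hRs, ContinuousLinearMap.star_eq_adjoint]
      rw [ContinuousLinearMap.adjoint_inner_left, ContinuousLinearMap.adjoint_inner_left]
    have h3 : ‖inner ℂ (f i) (A (e i))‖ₑ ≤ ‖R (star K (f i))‖ₑ := by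
      rw [h2, ← ofReal_norm, ← ofReal_norm]
      refine ENNReal.ofReal_le_ofReal ((norm_inner_le_norm _ _).trans ?_)
      rw [he.1 i, mul_one]
    have h4 := norm_rpow_half_le hZ (p := q / 2) (by linarith) hw
    calc _ ≤ ‖R (star K (f i))‖ₑ ^ q := ENNReal.rpow_le_rpow h3 (by linarith)
      _ = (‖R (star K (f i))‖ₑ ^ 2) ^ (q / 2) := by
        rw [← ENNReal.rpow_two, ← ENNReal.rpow_mul]; congr 1; ring
      _ ≤ _ := h4
  refine (ENNReal.tsum_le_tsum h1).trans ((tsum_orthonormal_le hf c _).trans (le_of_eq ?_))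
  rw [star_mul, star_star, hVs]
  rfl

/-- Both operators factor through `Z^(1/2)`, where `Z = A^* A + B^* B`. The Hilbert-Schmidt bounds
for the two factors `K`, `L` add up, because `‖K x‖^2 + ‖L x‖^2 ≤ ‖x‖^2`. -/
theorem schattenPow_add_le_opTrace {A B : H →L[ℂ] H} (hA : IsCompactOperator A)
    (hB : IsCompactOperator B) {q : ℝ} (hq : 2 ≤ q) :
    schattenPow q A + schattenPow q B ≤ opTrace ((star A * A + star B * B) ^ (q / 2)) := by
  set Z := star A * A + star B * B with hZ
  have hZ0 : 0 ≤ Z := add_nonneg (star_mul_self_nonneg A) (star_mul_self_nonneg B)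
  have hnorm : ∀ x, ‖A x‖ ^ 2 + ‖B x‖ ^ 2 = ‖(Z ^ (1 / 2 : ℝ)) x‖ ^ 2 := by
    intro x
    have h1 : ∀ C : H →L[ℂ] H, (inner ℂ x ((star C * C) x)).re = ‖C x‖ ^ 2 := by
      intro C
      rw [op_mul_apply, ContinuousLinearMap.star_eq_adjoint,
        ContinuousLinearMap.adjoint_inner_right, inner_self_eq_norm_sq_to_K]
      simp [← Complex.ofReal_pow]
    rw [← h1, ← h1, ← h1, ← rpow_eq_star_mul hZ0 zero_le_one, CFC.rpow_one Z, hZ, add_apply,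
      inner_add_right, Complex.add_re]
  obtain ⟨K, L, hK, hL, hKL⟩ := exists_contraction_factor_pair A B _ hnorm
  have hle : ∀ (P Q : H →L[ℂ] H), (∀ x, ‖P x‖ ^ 2 + ‖Q x‖ ^ 2 ≤ ‖x‖ ^ 2) → ‖P‖ ≤ 1 := by
    intro P Q h
    refine ContinuousLinearMap.opNorm_le_bound _ zero_le_one fun x => ?_
    rw [one_mul, ← sq_le_sq₀ (norm_nonneg _) (norm_nonneg _)]
    nlinarith [h x, sq_nonneg ‖Q x‖]
  obtain ⟨w, c, hc⟩ := exists_hilbertBasis ℂ H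
  have h1 := schattenPow_le_of_factor hZ0 hA hK (hle K L hKL) hq c
  have h2 := schattenPow_le_of_factor hZ0 hB hL
    (hle L K fun x => by rw [add_comm]; exact hKL x) hq c
  refine (add_le_add h1 h2).trans ?_
  rw [← ENNReal.tsum_add, rpow_eq_star_mul hZ0 (r := q / 2) (by linarith),
    opTrace_star_mul c]
  refine ENNReal.tsum_le_tsum fun j => ?_
  simp only [← ofReal_norm, ← ENNReal.ofReal_pow (norm_nonneg _)]
  rw [← ENNReal.ofReal_add (by positivity) (by positivity)]
  exact ENNReal.ofReal_le_ofReal (hKL _)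

/-- Jensen's inequality for `X^* X` with exponent `q / 2 ≥ 1`. -/
theorem tsum_apply_rpow_le {ι : Type*} {w : ι → H} (hw : Orthonormal ℂ w) {q : ℝ} (hq : 2 ≤ q)
    (X : H →L[ℂ] H) : ∑' i, ‖X (w i)‖ₑ ^ q ≤ schattenPow q X := by
  have hB : 0 ≤ star X * X := star_mul_self_nonneg X
  rw [schattenPow, rpow_eq_star_mul hB (by linarith)]
  refine le_trans (ENNReal.tsum_le_tsum fun i => ?_) (tsum_orthonormal_le_opTrace hw _)
  refine le_trans (le_of_eq ?_) (norm_rpow_half_le hB (p := q / 2) (by linarith) (hw.1 i).le)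
  have h1 : ‖((star X * X) ^ (1 / 2 : ℝ)) (w i)‖ₑ = ‖X (w i)‖ₑ := by
    rw [← ofReal_norm, ← ofReal_norm, ← norm_abs_apply X, CFC.abs, CFC.sqrt_eq_rpow]
  rw [h1, ← ENNReal.rpow_two, ← ENNReal.rpow_mul]
  congr 1; ring

/-- By the parallelogram law, the eigenvalue of `Z` at a basis eigenvector `b` is `(‖X b‖^2 + ‖Y
b‖^2) / 2`. Convexity of `x^(q/2)` separates `X` from `Y` in the trace. -/
theorem opTrace_midpoint_le {X Y : H →L[ℂ] H} (hX : IsCompactOperator X)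
    (hY : IsCompactOperator Y) {q : ℝ} (hq : 2 ≤ q) {A B : H →L[ℂ] H}
    (hA : A = (1 / 2 : ℂ) • (X + Y)) (hB : B = (1 / 2 : ℂ) • (X - Y)) :
    opTrace ((star A * A + star B * B) ^ (q / 2)) ≤ (schattenPow q X + schattenPow q Y) / 2 := by
  have hAc : IsCompactOperator A := by rw [hA]; exact (hX.add hY).smul _
  have hBc : IsCompactOperator B := by rw [hB]; exact (hX.sub hY).smul _
  set Z := star A * A + star B * B with hZ
  have hZ0 : 0 ≤ Z := add_nonneg (star_mul_self_nonneg A) (star_mul_self_nonneg B)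
  have hZc : IsCompactOperator Z := (hAc.clm_comp (star A)).add (hBc.clm_comp (star B))
  obtain ⟨ι, b, c, hb⟩ := exists_eigenbasis (IsSelfAdjoint.of_nonneg hZ0) hZc
  have h1 : ∀ (C : H →L[ℂ] H) x, inner ℂ x ((star C * C) x) = ((‖C x‖ ^ 2 : ℝ) : ℂ) := by
    intro C x
    rw [op_mul_apply, ContinuousLinearMap.star_eq_adjoint,
      ContinuousLinearMap.adjoint_inner_right, inner_self_eq_norm_sq_to_K]
    simp
  have hc : ∀ i, c i = (((‖X (b i)‖ ^ 2 + ‖Y (b i)‖ ^ 2) / 2 : ℝ) : ℂ) := by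
    intro i
    have h : inner ℂ (b i) (Z (b i)) = c i * inner ℂ (b i) (b i) := by
      rw [← inner_smul_right, ← hb]
    rw [inner_self_eq_norm_sq_to_K, b.orthonormal.1 i, hZ, add_apply, inner_add_right, h1, h1] at h
    have h2 : ‖A (b i)‖ ^ 2 + ‖B (b i)‖ ^ 2 = (‖X (b i)‖ ^ 2 + ‖Y (b i)‖ ^ 2) / 2 := by
      have h3 := parallelogram_law_with_norm ℂ (X (b i)) (Y (b i))
      rw [hA, hB, smul_apply, smul_apply, add_apply, sub_apply, norm_smul, norm_smul]
      norm_num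
      nlinarith
    rw [← h2]
    simpa using h.symm
  have hs : opTrace (Z ^ (q / 2))
      = ∑' i, ENNReal.ofReal (((‖X (b i)‖ ^ 2 + ‖Y (b i)‖ ^ 2) / 2) ^ (q / 2)) := by
    rw [opTrace_eq b CFC.rpow_nonneg]
    congr 1; ext i
    rw [rpow_apply_eigenvector hZ0 ((hb i).trans (by rw [hc i])) (by linarith), inner_smul_right,
      inner_self_eq_norm_sq_to_K, b.orthonormal.1 i]
    simp only [Complex.coe_algebraMap, Complex.ofReal_one, one_pow, mul_one, Complex.ofReal_re]
  have hX2 := tsum_apply_rpow_le b.orthonormal hq X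
  have hY2 := tsum_apply_rpow_le b.orthonormal hq Y
  calc _ ≤ ∑' i, (‖X (b i)‖ₑ ^ q + ‖Y (b i)‖ₑ ^ q) / 2 := by
        rw [hs]
        refine ENNReal.tsum_le_tsum fun i => ?_
        set x := ‖X (b i)‖ with hx
        set y := ‖Y (b i)‖ with hy
        have hx0 : 0 ≤ x := norm_nonneg _
        have hy0 : 0 ≤ y := norm_nonneg _
        have h3 : ((1 / 2 : ℝ) • x ^ 2 + (1 / 2 : ℝ) • y ^ 2) ^ (q / 2)
            ≤ (1 / 2 : ℝ) • (x ^ 2) ^ (q / 2) + (1 / 2 : ℝ) • (y ^ 2) ^ (q / 2) :=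
          (convexOn_rpow (by linarith)).2 (Set.mem_Ici.2 (sq_nonneg x))
            (Set.mem_Ici.2 (sq_nonneg y)) (by norm_num) (by norm_num) (by norm_num)
        simp only [smul_eq_mul] at h3
        have h4 : ∀ z : ℝ, 0 ≤ z → (z ^ 2) ^ (q / 2) = z ^ q := by
          intro z hz
          rw [← Real.rpow_natCast, ← Real.rpow_mul hz]; congr 1; push_cast; ring
        rw [h4 x hx0, h4 y hy0] at h3
        have h5 : ((x ^ 2 + y ^ 2) / 2) ^ (q / 2) ≤ (x ^ q + y ^ q) / 2 := by
          convert h3 using 1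
          · congr 1; ring
          · ring
        refine (ENNReal.ofReal_le_ofReal h5).trans (le_of_eq ?_)
        rw [ENNReal.ofReal_div_of_pos two_pos, ENNReal.ofReal_add (by positivity) (by positivity),
          ← ENNReal.ofReal_rpow_of_nonneg hx0 (by linarith),
          ← ENNReal.ofReal_rpow_of_nonneg hy0 (by linarith), hx, hy, ofReal_norm, ofReal_norm]
        simp
    _ = (∑' i, ‖X (b i)‖ₑ ^ q + ∑' i, ‖Y (b i)‖ₑ ^ q) / 2 := by
      simp_rw [div_eq_mul_inv]
      rw [ENNReal.tsum_mul_right, ENNReal.tsum_add]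
    _ ≤ _ := by gcongr

/-- Clarkson's inequality in the Schatten classes, for exponents at least two. -/
theorem schattenPow_clarkson {X Y : H →L[ℂ] H} (hX : IsCompactOperator X)
    (hY : IsCompactOperator Y) {q : ℝ} (hq : 2 ≤ q) :
    schattenPow q ((1 / 2 : ℂ) • (X + Y)) + schattenPow q ((1 / 2 : ℂ) • (X - Y))
      ≤ (schattenPow q X + schattenPow q Y) / 2 :=
  (schattenPow_add_le_opTrace (IsCompactOperator.smul (hX.add hY) _)
    (IsCompactOperator.smul (hX.sub hY) _) hq).trans (opTrace_midpoint_le hX hY hq rfl rfl)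

end Clarkson
-- Inequalities between real numbers.
section ScalarInequalities

theorem exists_young_epsilon {α β p : ℝ} (hα : 0 < α) (hβ : 0 < β) (hp : α + β = p) {ε : ℝ}
    (hε : 0 < ε) : ∃ K : ℝ, 0 ≤ K ∧ ∀ a b : ℝ, 0 ≤ a → 0 ≤ b →
      a ^ α * b ^ β ≤ ε * b ^ p + K * a ^ p := by
  -- The threshold solves `δ^α = ε`: if `a ≤ δ b` the first term on the right dominates, otherwise
  -- the second.
  set δ := ε ^ α⁻¹ with hδ
  have hδ0 : 0 < δ := Real.rpow_pos_of_pos hε _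
  have hδα : δ ^ α = ε := by rw [hδ, ← Real.rpow_mul hε.le, inv_mul_cancel₀ hα.ne', Real.rpow_one]
  refine ⟨(δ⁻¹) ^ β, by positivity, fun a b ha hb => ?_⟩
  have hadd : ∀ x : ℝ, 0 ≤ x → x ^ p = x ^ α * x ^ β := fun x hx => by
    rw [← hp, Real.rpow_add_of_nonneg hx hα.le hβ.le]
  rcases le_total a (δ * b) with h | h
  · have h1 : a ^ α ≤ ε * b ^ α := by
      rw [← hδα, ← Real.mul_rpow hδ0.le hb]
      exact Real.rpow_le_rpow ha h hα.le
    calc a ^ α * b ^ β ≤ ε * b ^ α * b ^ β := by gcongr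
      _ = ε * b ^ p := by rw [hadd b hb]; ring
      _ ≤ _ := le_add_of_nonneg_right (by positivity)
  · have h1 : b ^ β ≤ (δ⁻¹) ^ β * a ^ β := by
      rw [← Real.mul_rpow (by positivity) ha]
      refine Real.rpow_le_rpow hb ?_ hβ.le
      rw [inv_mul_eq_div, le_div_iff₀ hδ0]; linarith
    calc a ^ α * b ^ β ≤ a ^ α * ((δ⁻¹) ^ β * a ^ β) := by gcongr
      _ = (δ⁻¹) ^ β * a ^ p := by rw [hadd a ha]; ring
      _ ≤ _ := le_add_of_nonneg_left (by positivity)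

theorem one_sub_rpow_le {u b : ℝ} (hu : 0 ≤ u) (hu1 : u ≤ 1) :
    1 - u ^ b ≤ max 1 b * (1 - u) := by
  rcases le_total 1 b with h | h
  · have := one_add_mul_self_le_rpow_one_add (s := u - 1) (by linarith) h
    rw [add_sub_cancel] at this
    rw [max_eq_right h]; linarith
  · have : u ^ (1 : ℝ) ≤ u ^ b := Real.rpow_le_rpow_of_exponent_ge_of_imp hu hu1 h (by simp)
    rw [Real.rpow_one] at this
    rw [max_eq_left h]; linarith

theorem le_one_sub_rpow {u b : ℝ} (hu : 0 ≤ u) (hu1 : u ≤ 1) (hb : 0 < b) :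
    min 1 b * (1 - u) ≤ 1 - u ^ b := by
  rcases le_total 1 b with h | h
  · have : u ^ b ≤ u ^ (1 : ℝ) := Real.rpow_le_rpow_of_exponent_ge_of_imp hu hu1 h fun _ h0 => absurd h0 hb.ne'
    rw [Real.rpow_one] at this
    rw [min_eq_left h]; linarith
  · have := rpow_one_add_le_one_add_mul_self (s := u - 1) (by linarith) hb.le h
    rw [add_sub_cancel] at this
    rw [min_eq_right h]; linarith

/-- After scaling to `t = 1`, `s = u ≤ 1`, the identity `1 + u^p - u^r - u^(p-r) = (1 - u^r)(1 -
u^(p-r))` reduces the upper bound to comparing such products for `r` and for `1`; each is of order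
`(1 - u)^2`. The absolute value is there because the overlaps that multiply this expression may have
either sign. -/
theorem exists_mixedPow_compare {p r : ℝ} (hp : 1 < p) (hr : 0 < r) (hrp : r < p) :
    ∃ C : ℝ, 1 ≤ C ∧ ∀ t s : ℝ, 0 < t → 0 < s →
      |C * (t ^ (p - 1) * s ^ (1 : ℝ) + s ^ (p - 1) * t ^ (1 : ℝ))
          - (t ^ (p - r) * s ^ r + s ^ (p - r) * t ^ r)| ≤ (C - 1) * (t ^ p + s ^ p) := by
  set m := min 1 (p - 1) with hm
  have hm0 : 0 < m := lt_min one_pos (by linarith)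
  -- `D` collects the Bernoulli constants that turn each factor `1 - u^b` into a multiple of `1 -
  -- u`. The lower half of the absolute value needs `C ≥ 2`.
  set D := max 1 (p - r) * max 1 r / m with hD
  have hD0 : 0 ≤ D := by positivity
  set C := max 2 D with hC
  have hC2 : 2 ≤ C := le_max_left _ _
  refine ⟨C, by linarith, ?_⟩
  have hpow : ∀ a u : ℝ, 0 < a → a < p → 0 < u → u ^ (p - a) * u ^ a = u ^ p := by
    intro a u _ _ hu
    rw [← Real.rpow_add hu, sub_add_cancel]
  have hunit : ∀ u : ℝ, 0 < u → u ≤ 1 →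
      |C * (u ^ (1 : ℝ) + u ^ (p - 1)) - (u ^ r + u ^ (p - r))| ≤ (C - 1) * (1 + u ^ p) := by
    intro u hu hu1
    have e1 := hpow 1 u one_pos hp hu
    have e2 := hpow r u hr hrp hu
    rw [Real.rpow_one] at e1 ⊢
    have a1 : m * (1 - u) ≤ 1 - u ^ (p - 1) := le_one_sub_rpow hu.le hu1 (by linarith)
    have a2 := one_sub_rpow_le hu.le hu1 (b := r)
    have a3 := one_sub_rpow_le hu.le hu1 (b := p - r)
    have b2 : u ^ r ≤ 1 := Real.rpow_le_one hu.le hu1 hr.le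
    have b3 : u ^ (p - r) ≤ 1 := Real.rpow_le_one hu.le hu1 (by linarith)
    have b1 : u ^ (p - 1) ≤ 1 := Real.rpow_le_one hu.le hu1 (by linarith)
    have hup : 0 < u ^ p := Real.rpow_pos_of_pos hu p
    have hup1 : 0 < u ^ (p - 1) := Real.rpow_pos_of_pos hu _
    have c1 : (1 - u ^ (p - r)) * (1 - u ^ r) ≤ C * ((1 - u ^ (p - 1)) * (1 - u)) := by
      calc (1 - u ^ (p - r)) * (1 - u ^ r)
          ≤ (max 1 (p - r) * (1 - u)) * (max 1 r * (1 - u)) :=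
            mul_le_mul a3 a2 (by linarith) (mul_nonneg (by positivity) (by linarith))
        _ = D * ((m * (1 - u)) * (1 - u)) := by rw [hD]; field_simp
        _ ≤ D * ((1 - u ^ (p - 1)) * (1 - u)) :=
            mul_le_mul_of_nonneg_left (mul_le_mul_of_nonneg_right a1 (by linarith)) hD0
        _ ≤ C * ((1 - u ^ (p - 1)) * (1 - u)) :=
            mul_le_mul_of_nonneg_right (le_max_right _ _)
              (mul_nonneg (by linarith) (by linarith))
    have c2 : 0 ≤ (1 - u ^ (p - r)) * (1 - u ^ r) := mul_nonneg (by linarith) (by linarith)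
    have c3 : 0 ≤ C * (u + u ^ (p - 1)) := by positivity
    rw [abs_le]
    constructor
    · nlinarith
    · nlinarith
  have hord : ∀ t s : ℝ, 0 < t → 0 < s → s ≤ t →
      |C * (t ^ (p - 1) * s ^ (1 : ℝ) + s ^ (p - 1) * t ^ (1 : ℝ))
          - (t ^ (p - r) * s ^ r + s ^ (p - r) * t ^ r)| ≤ (C - 1) * (t ^ p + s ^ p) := by
    intro t s ht hs hst
    set u := s / t with hu
    have hu0 : 0 < u := div_pos hs ht
    have hsu : s = t * u := by rw [hu]; field_simp
    have htp : 0 < t ^ p := Real.rpow_pos_of_pos ht p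
    have h1 : ∀ a : ℝ, 0 < a → a < p →
        t ^ (p - a) * s ^ a + s ^ (p - a) * t ^ a = t ^ p * (u ^ a + u ^ (p - a)) := by
      intro a ha hap
      rw [hsu, Real.mul_rpow ht.le hu0.le, Real.mul_rpow ht.le hu0.le, ← hpow a t ha hap ht]
      ring
    rw [h1 1 one_pos hp, h1 r hr hrp]
    have h2 : t ^ p + s ^ p = t ^ p * (1 + u ^ p) := by
      rw [hsu, Real.mul_rpow ht.le hu0.le]; ring
    rw [h2]
    have h3 := mul_le_mul_of_nonneg_left (hunit u hu0 ((div_le_one ht).2 hst)) htp.le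
    rw [← abs_of_pos htp, ← abs_mul, abs_of_pos htp] at h3
    calc _ = |t ^ p * (C * (u ^ (1 : ℝ) + u ^ (p - 1)) - (u ^ r + u ^ (p - r)))| := by
          congr 1; ring
      _ ≤ _ := h3
      _ = _ := by ring
  intro t s ht hs
  rcases le_total s t with h | h
  · exact hord t s ht hs h
  · have h1 := hord s t hs ht h
    rw [add_comm (s ^ (p - 1) * _), add_comm (s ^ (p - r) * _), add_comm (s ^ p)] at h1
    exact h1

theorem rpow_sub_mul_rpow_le {p r t s : ℝ} (hr : 0 < r) (hrp : r < p) (ht : 0 < t) (hs : 0 < s) :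
    t ^ (p - r) * s ^ r ≤ t ^ p + s ^ p := by
  have hpow : ∀ u : ℝ, 0 < u → u ^ (p - r) * u ^ r = u ^ p := fun u hu => by
    rw [← Real.rpow_add hu, sub_add_cancel]
  have ht0 : 0 < t ^ p := Real.rpow_pos_of_pos ht p
  have hs0 : 0 < s ^ p := Real.rpow_pos_of_pos hs p
  rcases le_total s t with h | h
  · have : t ^ (p - r) * s ^ r ≤ t ^ (p - r) * t ^ r := by gcongr
    rw [hpow t ht] at this; linarith
  · have : t ^ (p - r) * s ^ r ≤ s ^ (p - r) * s ^ r := by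
      gcongr
    rw [hpow s hs] at this; linarith

theorem summable_mul_substochastic {ι κ : Type*} {u : ι → ℝ} {n : ι → κ → ℝ} (hu : ∀ i, 0 ≤ u i)
    (hn : ∀ i j, 0 ≤ n i j) (hus : Summable u) (hns : ∀ i, Summable (n i))
    (hn1 : ∀ i, ∑' j, n i j ≤ 1) :
    (Summable fun x : ι × κ => u x.1 * n x.1 x.2) ∧
      ∑' x : ι × κ, u x.1 * n x.1 x.2 ≤ ∑' i, u i := by
  have h0 : ∀ i, ∑' j, u i * n i j ≤ u i := fun i => by
    rw [tsum_mul_left]; exact mul_le_of_le_one_right (hu i) (hn1 i)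
  have h1 : Summable fun i => ∑' j, u i * n i j :=
    Summable.of_nonneg_of_le (fun i => tsum_nonneg fun j => mul_nonneg (hu i) (hn i j)) h0 hus
  have h2 : Summable fun x : ι × κ => u x.1 * n x.1 x.2 :=
    (summable_prod_of_nonneg fun x => mul_nonneg (hu _) (hn _ _)).2
      ⟨fun i => (hns i).mul_left (u i), h1⟩
  refine ⟨h2, ?_⟩
  rw [h2.tsum_prod]
  exact h1.tsum_le_tsum h0 hus

end ScalarInequalities
-- Trace pairings and strong monotonicity of the duality map.
section Pairing

universe u

variable {H : Type u} [NormedAddCommGroup H] [InnerProductSpace ℂ H] [CompleteSpace H]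

open SchattenAux

theorem ne_top_of_mem_schattenIdeal {p : ℝ} [Fact (1 ≤ p)] {T : H →L[ℂ] H}
    (hT : T ∈ schattenIdeal H p) : schattenPow p T ≠ ⊤ :=
  hT.2.ne

/-- The real trace pairing `∑ tᵢ^a Re ⟨fᵢ, Z eᵢ⟩` of `sign(T)|T|^a` with `Z`, in terms of the singular
system `e, f, t` of `T`. -/
noncomputable def singularPairing {ι : Type*} (a : ℝ) (e f : ι → H) (t : ι → ℝ)
    (Z : H →L[ℂ] H) : ℝ :=
  ∑' i, t i ^ a * (inner ℂ (f i) (Z (e i))).re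

variable {ι κ : Type u} {T S : H →L[ℂ] H} {e f : ι → H} {t : ι → ℝ} {g h : κ → H} {s : κ → ℝ}

theorem IsSingularSystem.pairing_summable (hT : IsSingularSystem T e f t) {p : ℝ} (hp : 1 < p)
    (hTp : schattenPow p T ≠ ⊤) {Z : H →L[ℂ] H} (hZ : schattenPow p Z ≠ ⊤) :
    Summable fun i => t i ^ (p - 1) * (inner ℂ (f i) (Z (e i))).re := by
  obtain ⟨K, -, hK⟩ := exists_young_epsilon (α := 1) (β := p - 1) (p := p) one_pos (by linarith)
    (by ring) one_pos
  have hz := (summable_inner_rpow hT.left hT.right hp.le hZ).1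
  refine Summable.of_norm_bounded
    (((hT.summable (by linarith) hTp).mul_left 1).add (hz.mul_left K)) fun i => ?_
  have h1 := hK ‖inner ℂ (f i) (Z (e i))‖ (t i) (norm_nonneg _) (hT.pos i).le
  rw [Real.rpow_one] at h1
  refine le_trans ?_ h1
  rw [norm_mul, Real.norm_of_nonneg (Real.rpow_nonneg (hT.pos i).le _), mul_comm]
  gcongr
  · exact Real.rpow_nonneg (hT.pos i).le _
  · exact Complex.abs_re_le_norm _

/-- Termwise Young inequality. `K` is fixed before the operators, a uniformity needed for
integration over `X`. -/
theorem exists_pairing_le {p : ℝ} (hp : 1 < p) {ε : ℝ} (hε : 0 < ε) :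
    ∃ K : ℝ, 0 ≤ K ∧ ∀ {ι : Type u} {T : H →L[ℂ] H} {e f : ι → H} {t : ι → ℝ} {Z : H →L[ℂ] H},
      IsSingularSystem T e f t → schattenPow p T ≠ ⊤ → schattenPow p Z ≠ ⊤ →
      singularPairing (p - 1) e f t Z
        ≤ ε * (schattenPow p T).toReal + K * (schattenPow p Z).toReal := by
  obtain ⟨K, hK0, hK⟩ := exists_young_epsilon (α := 1) (β := p - 1) (p := p) one_pos
    (by linarith) (by ring) hε
  refine ⟨K, hK0, fun {ι T e f t Z} hT hTp hZ => ?_⟩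
  obtain ⟨hz, hz1⟩ := summable_inner_rpow hT.left hT.right hp.le hZ
  have hs := hT.summable (by linarith) hTp
  calc singularPairing (p - 1) e f t Z
      ≤ ∑' i, (ε * t i ^ p + K * ‖inner ℂ (f i) (Z (e i))‖ ^ p) := by
        refine (hT.pairing_summable hp hTp hZ).tsum_le_tsum (fun i => ?_)
          ((hs.mul_left ε).add (hz.mul_left K))
        have h1 := hK ‖inner ℂ (f i) (Z (e i))‖ (t i) (norm_nonneg _) (hT.pos i).le
        rw [Real.rpow_one] at h1
        refine le_trans ?_ h1
        rw [mul_comm]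
        gcongr
        · exact Real.rpow_nonneg (hT.pos i).le _
        · exact Complex.re_le_norm _
    _ = ε * ∑' i, t i ^ p + K * ∑' i, ‖inner ℂ (f i) (Z (e i))‖ ^ p := by
        rw [(hs.mul_left ε).tsum_add (hz.mul_left K), tsum_mul_left, tsum_mul_left]
    _ ≤ _ := by
        rw [hT.toReal_schattenPow (by linarith)]
        gcongr

/-- The tangent inequality for the convex function `Trace(|·|^q)` at `X`. -/
theorem IsSingularSystem.pairing_le_tangent (hT : IsSingularSystem T e f t) {q : ℝ} (hq : 1 < q)
    (hTq : schattenPow q T ≠ ⊤) {Z : H →L[ℂ] H} (hZ : schattenPow q Z ≠ ⊤) :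
    q * singularPairing (q - 1) e f t Z
      ≤ (q - 1) * (schattenPow q T).toReal + (schattenPow q Z).toReal := by
  have hq0 : 0 < q := by linarith
  obtain ⟨hz, hz1⟩ := summable_inner_rpow hT.left hT.right hq.le hZ
  have hs := hT.summable hq0 hTq
  calc q * singularPairing (q - 1) e f t Z
      = ∑' i, q * (t i ^ (q - 1) * (inner ℂ (f i) (Z (e i))).re) := tsum_mul_left.symm
    _ ≤ ∑' i, ((q - 1) * t i ^ q + ‖inner ℂ (f i) (Z (e i))‖ ^ q) := by
        refine ((hT.pairing_summable hq hTq hZ).mul_left q).tsum_le_tsum (fun i => ?_)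
          ((hs.mul_left (q - 1)).add hz)
        set z := ‖inner ℂ (f i) (Z (e i))‖
        have hti := (hT.pos i).le
        have hy := Real.young_inequality_of_nonneg (Real.rpow_nonneg hti (q - 1))
          (norm_nonneg (inner ℂ (f i) (Z (e i)))) (Real.HolderConjugate.conjExponent hq).symm
        rw [← Real.rpow_mul hti, Real.conjExponent, mul_div_cancel₀ _ (by linarith : q - 1 ≠ 0)]
          at hy
        have h1 : t i ^ (q - 1) * (inner ℂ (f i) (Z (e i))).re ≤ t i ^ (q - 1) * z :=
          mul_le_mul_of_nonneg_left (Complex.re_le_norm _) (Real.rpow_nonneg hti _)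
        have h2 : q * (t i ^ q / (q / (q - 1)) + z ^ q / q) = (q - 1) * t i ^ q + z ^ q := by
          field_simp
        rw [← h2]
        exact mul_le_mul_of_nonneg_left (h1.trans hy) hq0.le
    _ = (q - 1) * ∑' i, t i ^ q + ∑' i, ‖inner ℂ (f i) (Z (e i))‖ ^ q := by
        rw [(hs.mul_left (q - 1)).tsum_add hz, tsum_mul_left]
    _ ≤ _ := by
        rw [hT.toReal_schattenPow hq0]
        gcongr

theorem schattenPow_smul_le {A : H →L[ℂ] H} (hA : IsCompactOperator A) (c : ℂ) {p : ℝ}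
    (hp : 1 ≤ p) : schattenPow p (c • A) ≤ ‖c‖ₑ ^ p * schattenPow p A := by
  have hp0 : 0 < p := by linarith
  have := ENNReal.rpow_le_rpow (opTrace_rpow_smul_le hA c hp) hp0.le
  rwa [ENNReal.mul_rpow_of_nonneg _ _ hp0.le, ← ENNReal.rpow_mul, ← ENNReal.rpow_mul,
    one_div_mul_cancel hp0.ne', ENNReal.rpow_one, ENNReal.rpow_one] at this

/-- The duality map of the Schatten class of exponent `q ≥ 2` is strongly monotone. -/
theorem schattenPow_sub_le_pairing {q : ℝ} [Fact (1 ≤ q)] (hq : 2 ≤ q)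
    (hT : IsSingularSystem T e f t) (hS : IsSingularSystem S g h s)
    (hTq : T ∈ schattenIdeal H q) (hSq : S ∈ schattenIdeal H q) :
    (schattenPow q (T - S)).toReal ≤ 2 ^ q * (q / 4) *
      (singularPairing (q - 1) e f t (T - S) + singularPairing (q - 1) g h s (S - T)) := by
  have hq1 : 1 < q := by linarith
  have hq0 : 0 < q := by linarith
  set A := (1 / 2 : ℂ) • (T + S) with hA
  set B := (1 / 2 : ℂ) • (T - S) with hB
  have hAq : A ∈ schattenIdeal H q := Submodule.smul_mem _ _ (Submodule.add_mem _ hTq hSq)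
  have hDq : T - S ∈ schattenIdeal H q := Submodule.sub_mem _ hTq hSq
  have hDq' : S - T ∈ schattenIdeal H q := Submodule.sub_mem _ hSq hTq
  have hBq : B ∈ schattenIdeal H q := Submodule.smul_mem _ _ hDq
  have fT := ne_top_of_mem_schattenIdeal hTq
  have fS := ne_top_of_mem_schattenIdeal hSq
  have fA := ne_top_of_mem_schattenIdeal hAq
  have fB := ne_top_of_mem_schattenIdeal hBq
  have hcl : (schattenPow q A).toReal + (schattenPow q B).toReal
      ≤ ((schattenPow q T).toReal + (schattenPow q S).toReal) / 2 := by
    have h1 := schattenPow_clarkson hTq.1 hSq.1 hq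
    have h2 := ENNReal.toReal_mono (ENNReal.div_ne_top (ENNReal.add_ne_top.2 ⟨fT, fS⟩)
      two_ne_zero) h1
    rwa [ENNReal.toReal_add fA fB, ENNReal.toReal_div, ENNReal.toReal_add fT fS,
      ENNReal.toReal_ofNat] at h2
  -- The midpoint is `T - (T - S) / 2`, and `T` pairs with itself to `Tr |T|^q`.
  have key : ∀ {ι : Type u} {T S : H →L[ℂ] H} {e f : ι → H} {t : ι → ℝ},
      IsSingularSystem T e f t → schattenPow q T ≠ ⊤ → schattenPow q (T - S) ≠ ⊤ →
      singularPairing (q - 1) e f t ((1 / 2 : ℂ) • (T + S))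
        = (schattenPow q T).toReal - singularPairing (q - 1) e f t (T - S) / 2 := by
    intro ι T S e f t hT fT fD
    rw [hT.toReal_schattenPow hq0, singularPairing, singularPairing, ← tsum_div_const,
      ← (hT.summable hq0 fT).tsum_sub ((hT.pairing_summable hq1 fT fD).div_const 2)]
    refine tsum_congr fun i => ?_
    have h1 : (inner ℂ (f i) (T (e i))).re = t i := by
      have := hT.inner_opMazur_left one_pos i
      rwa [opMazur_one, Real.rpow_one] at this
    have h2 : t i ^ q = t i ^ (q - 1) * t i := by
      rw [Real.rpow_sub_one (hT.pos i).ne', div_mul_cancel₀ _ (hT.pos i).ne']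
    have h3 : ((1 / 2 : ℂ) * (inner ℂ (f i) (T (e i)) + inner ℂ (f i) (S (e i)))).re
        = ((inner ℂ (f i) (T (e i))).re + (inner ℂ (f i) (S (e i))).re) / 2 := by
      rw [show (1 / 2 : ℂ) = ((1 / 2 : ℝ) : ℂ) by push_cast; rfl, Complex.re_ofReal_mul,
        Complex.add_re]
      ring
    rw [smul_apply, add_apply, sub_apply, inner_smul_right, inner_add_right, inner_sub_right, h3,
      Complex.sub_re, h1, h2]
    ring
  -- The tangents at `T` and `S` are both evaluated at the midpoint `A`. Their sum bounds `Tr |A|^q`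
  -- from below; inserted in Clarkson's inequality it leaves `Tr |B|^q` at most `q / 4` times the
  -- sum of the pairings.
  have t1 := hT.pairing_le_tangent hq1 fT fA
  have t2 := hS.pairing_le_tangent hq1 fS fA
  rw [hA, key hT fT (ne_top_of_mem_schattenIdeal hDq)] at t1
  rw [hA, add_comm T S, key hS fS (ne_top_of_mem_schattenIdeal hDq'), add_comm S T] at t2
  rw [← hA] at t1 t2
  have hsm : (schattenPow q (T - S)).toReal ≤ 2 ^ q * (schattenPow q B).toReal := by
    have h1 := schattenPow_smul_le hBq.1 2 hq1.le
    have h2 : (2 : ℂ) • B = T - S := by rw [hB, smul_smul]; norm_num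
    rw [h2] at h1
    have h3 : ‖(2 : ℂ)‖ₑ ^ q ≠ ⊤ := ENNReal.rpow_ne_top_of_nonneg hq0.le enorm_ne_top
    have h4 := ENNReal.toReal_mono (ENNReal.mul_ne_top h3 fB) h1
    rw [ENNReal.toReal_mul, ← ENNReal.toReal_rpow, toReal_enorm] at h4
    simpa using h4
  have h2q : (0 : ℝ) < 2 ^ q := by positivity
  have : (schattenPow q B).toReal ≤ q / 4 *
      (singularPairing (q - 1) e f t (T - S) + singularPairing (q - 1) g h s (S - T)) := by
    linarith
  calc _ ≤ _ := hsm
    _ ≤ 2 ^ q * (q / 4 * _) := mul_le_mul_of_nonneg_left this h2q.le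
    _ = _ := by ring

end Pairing
-- Comparison of mixed energies, and the modulus for target exponents at least two.
section Comparison

universe u

variable {H : Type u} [NormedAddCommGroup H] [InnerProductSpace ℂ H] [CompleteSpace H]

open SchattenAux

variable {ι κ : Type u} {T S : H →L[ℂ] H} {e f : ι → H} {t : ι → ℝ} {g h : κ → H} {s : κ → ℝ}

/-- The overlap coefficients of two singular systems, averaged to a doubly substochastic matrix. -/
noncomputable def overlapWeight (e f : ι → H) (g h : κ → H) (x : ι × κ) : ℝ :=
  (‖inner ℂ (f x.1) (h x.2)‖ ^ 2 + ‖inner ℂ (e x.1) (g x.2)‖ ^ 2) / 2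

/-- The real overlap coefficients of two singular systems. -/
noncomputable def overlap (e f : ι → H) (g h : κ → H) (x : ι × κ) : ℝ :=
  (inner ℂ (f x.1) (h x.2) * inner ℂ (g x.2) (e x.1)).re

theorem abs_overlap_le (x : ι × κ) : |overlap e f g h x| ≤ overlapWeight e f g h x := by
  refine (Complex.abs_re_le_norm _).trans ?_
  rw [norm_mul, norm_inner_symm (g x.2), overlapWeight]
  nlinarith [sq_nonneg (‖inner ℂ (f x.1) (h x.2)‖ - ‖inner ℂ (e x.1) (g x.2)‖)]

/-- Bessel's inequality: the rows of `|⟨eᵢ, gⱼ⟩|^2` sum to at most one. -/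
theorem summable_orthonormal_weight {e : ι → H} {g : κ → H} (he : Orthonormal ℂ e)
    (hg : Orthonormal ℂ g) {u : ι → ℝ} (hu : ∀ i, 0 ≤ u i) (hus : Summable u) :
    (Summable fun x : ι × κ => u x.1 * ‖inner ℂ (e x.1) (g x.2)‖ ^ 2) ∧
      ∑' x : ι × κ, u x.1 * ‖inner ℂ (e x.1) (g x.2)‖ ^ 2 ≤ ∑' i, u i := by
  refine summable_mul_substochastic (n := fun i j => ‖inner ℂ (e i) (g j)‖ ^ 2) hu
    (fun _ _ => sq_nonneg _) hus (fun i => ?_) fun i => ?_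
  · simp_rw [norm_inner_symm (e i)]
    exact hg.inner_products_summable (e i)
  · simp_rw [norm_inner_symm (e i)]
    refine (hg.tsum_inner_products_le (e i)).trans ?_
    rw [he.1 i, one_pow]

theorem summable_overlapWeight_left (he : Orthonormal ℂ e) (hf : Orthonormal ℂ f)
    (hg : Orthonormal ℂ g) (hh : Orthonormal ℂ h) {u : ι → ℝ} (hu : ∀ i, 0 ≤ u i)
    (hus : Summable u) :
    (Summable fun x : ι × κ => u x.1 * overlapWeight e f g h x) ∧
      ∑' x : ι × κ, u x.1 * overlapWeight e f g h x ≤ ∑' i, u i := by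
  obtain ⟨a1, a2⟩ := summable_orthonormal_weight hf hh hu hus
  obtain ⟨b1, b2⟩ := summable_orthonormal_weight he hg hu hus
  have h1 : (fun x : ι × κ => u x.1 * overlapWeight e f g h x) = fun x : ι × κ =>
      (u x.1 * ‖inner ℂ (f x.1) (h x.2)‖ ^ 2 + u x.1 * ‖inner ℂ (e x.1) (g x.2)‖ ^ 2) / 2 := by
    ext x; rw [overlapWeight]; ring
  rw [h1]
  refine ⟨(a1.add b1).div_const 2, ?_⟩
  rw [tsum_div_const, a1.tsum_add b1]
  linarith

theorem overlapWeight_swap (x : κ × ι) :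
    overlapWeight e f g h x.swap = overlapWeight g h e f x := by
  simp only [overlapWeight, Prod.fst_swap, Prod.snd_swap]
  rw [norm_inner_symm (f x.2), norm_inner_symm (e x.2)]

theorem summable_overlapWeight_right (he : Orthonormal ℂ e) (hf : Orthonormal ℂ f)
    (hg : Orthonormal ℂ g) (hh : Orthonormal ℂ h) {u : κ → ℝ} (hu : ∀ i, 0 ≤ u i)
    (hus : Summable u) :
    (Summable fun x : ι × κ => u x.2 * overlapWeight e f g h x) ∧
      ∑' x : ι × κ, u x.2 * overlapWeight e f g h x ≤ ∑' i, u i := by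
  obtain ⟨a1, a2⟩ := summable_overlapWeight_left hg hh he hf hu hus
  have h1 : (fun x : ι × κ => u x.2 * overlapWeight e f g h x) ∘ (Equiv.prodComm κ ι)
      = fun x : κ × ι => u x.1 * overlapWeight g h e f x := by
    ext x
    exact congrArg (u x.1 * ·) (overlapWeight_swap x)
  constructor
  · rw [← (Equiv.prodComm κ ι).summable_iff, h1]; exact a1
  · rw [← (Equiv.prodComm κ ι).tsum_eq]
    exact (congrArg tsum h1).le.trans a2

/-- `Re Tr (sign(T)|T|^a - sign(S)|S|^a)^* (sign(T)|T|^(p-a) - sign(S)|S|^(p-a))`. -/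
noncomputable def mixedEnergy (p a : ℝ) (T S : H →L[ℂ] H) (e f : ι → H) (t : ι → ℝ) (g h : κ → H)
    (s : κ → ℝ) : ℝ :=
  singularPairing (p - a) e f t (opMazur a T - opMazur a S) +
    singularPairing (p - a) g h s (opMazur a S - opMazur a T)

theorem summable_mixed (hT : IsSingularSystem T e f t) (hS : IsSingularSystem S g h s) {p a : ℝ}
    (ha : 0 < a) (hap : a < p) (hTp : schattenPow p T ≠ ⊤) (hSp : schattenPow p S ≠ ⊤) :
    Summable fun x : ι × κ => t x.1 ^ (p - a) * s x.2 ^ a * overlap e f g h x := by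
  have hp : 0 < p := ha.trans hap
  have a1 := (summable_overlapWeight_left hT.left hT.right hS.left hS.right
    (fun i => Real.rpow_nonneg (hT.pos i).le p) (hT.summable hp hTp)).1
  have a2 := (summable_overlapWeight_right hT.left hT.right hS.left hS.right
    (fun i => Real.rpow_nonneg (hS.pos i).le p) (hS.summable hp hSp)).1
  refine Summable.of_norm_bounded (a1.add a2) fun x => ?_
  have h0 : 0 ≤ t x.1 ^ (p - a) * s x.2 ^ a :=
    mul_nonneg (Real.rpow_nonneg (hT.pos _).le _) (Real.rpow_nonneg (hS.pos _).le _)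
  rw [norm_mul, Real.norm_of_nonneg h0, ← add_mul, Real.norm_eq_abs]
  exact mul_le_mul (rpow_sub_mul_rpow_le ha hap (hT.pos _) (hS.pos _)) (abs_overlap_le x)
    (abs_nonneg _) (add_nonneg (Real.rpow_nonneg (hT.pos _).le _) (Real.rpow_nonneg (hS.pos _).le _))

theorem singularPairing_opMazur_sub (hT : IsSingularSystem T e f t) (hS : IsSingularSystem S g h s)
    {p a : ℝ} (ha : 0 < a) (hap : a < p) (hTp : schattenPow p T ≠ ⊤) (hSp : schattenPow p S ≠ ⊤) :
    singularPairing (p - a) e f t (opMazur a T - opMazur a S) = (schattenPow p T).toReal -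
      ∑' x : ι × κ, t x.1 ^ (p - a) * s x.2 ^ a * overlap e f g h x := by
  have hp : 0 < p := ha.trans hap
  have hsum := summable_mixed hT hS ha hap hTp hSp
  have h1 : ∀ i, HasSum (fun j => t i ^ (p - a) * s j ^ a * overlap e f g h (i, j))
      (t i ^ (p - a) * (inner ℂ (f i) (opMazur a S (e i))).re) := by
    intro i
    have := (hS.hasSum_inner ha (e i) (f i)).mul_left (t i ^ (p - a))
    simpa only [overlap, mul_assoc] using this
  have h2 := (hsum.hasSum.prod_fiberwise h1)
  rw [← h2.tsum_eq, hT.toReal_schattenPow hp, singularPairing,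
    ← (hT.summable hp hTp).tsum_sub h2.summable]
  refine tsum_congr fun i => ?_
  rw [sub_apply, inner_sub_right, Complex.sub_re, hT.inner_opMazur_left ha, mul_sub,
    ← Real.rpow_add (hT.pos i), sub_add_cancel]

theorem overlap_swap (x : κ × ι) : overlap e f g h x.swap = overlap g h e f x := by
  simp only [overlap, Prod.fst_swap, Prod.snd_swap]
  rw [← Complex.conj_re, map_mul, inner_conj_symm, inner_conj_symm]

/-- The exponent `a` enters only through the scalar coefficients, while traces and overlaps are the
same for all `a`. This is what makes energies of different exponents comparable. -/
theorem hasSum_mixedEnergy (hT : IsSingularSystem T e f t) (hS : IsSingularSystem S g h s)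
    {p a : ℝ} (ha : 0 < a) (hap : a < p) (hTp : schattenPow p T ≠ ⊤) (hSp : schattenPow p S ≠ ⊤) :
    HasSum (fun x : ι × κ =>
        (t x.1 ^ (p - a) * s x.2 ^ a + s x.2 ^ (p - a) * t x.1 ^ a) * overlap e f g h x)
      ((schattenPow p T).toReal + (schattenPow p S).toReal - mixedEnergy p a T S e f t g h s) := by
  have h1 := (summable_mixed hT hS ha hap hTp hSp).hasSum
  have h2 := (summable_mixed hS hT ha hap hSp hTp).hasSum
  have h3 : HasSum (fun x : ι × κ => s x.2 ^ (p - a) * t x.1 ^ a * overlap e f g h x)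
      (∑' x : κ × ι, s x.1 ^ (p - a) * t x.2 ^ a * overlap g h e f x) := by
    rw [← (Equiv.prodComm κ ι).hasSum_iff]
    convert h2 using 2 with x
    exact congrArg (s x.1 ^ (p - a) * t x.2 ^ a * ·) (overlap_swap x)
  rw [mixedEnergy, singularPairing_opMazur_sub hT hS ha hap hTp hSp,
    singularPairing_opMazur_sub hS hT ha hap hSp hTp]
  convert h1.add h3 using 1
  · ext x; ring
  · ring

/-- The mixed energies of different exponents are comparable. -/
theorem exists_mixedEnergy_le {p r : ℝ} (hp : 1 < p) (hr : 0 < r) (hrp : r < p) :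
    ∃ C : ℝ, 0 ≤ C ∧ ∀ {ι κ : Type u} {T S : H →L[ℂ] H} {e f : ι → H} {t : ι → ℝ} {g h : κ → H}
      {s : κ → ℝ}, IsSingularSystem T e f t → IsSingularSystem S g h s →
      schattenPow p T ≠ ⊤ → schattenPow p S ≠ ⊤ →
      mixedEnergy p r T S e f t g h s ≤ C * mixedEnergy p 1 T S e f t g h s := by
  obtain ⟨C, hC, hCk⟩ := exists_mixedPow_compare hp hr hrp
  refine ⟨C, by linarith, fun {ι κ T S e f t g h s} hT hS hTp hSp => ?_⟩
  have hp0 : 0 < p := by linarith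
  obtain ⟨a1, a2⟩ := summable_overlapWeight_left hT.left hT.right hS.left hS.right
    (fun i => Real.rpow_nonneg (hT.pos i).le p) (hT.summable hp0 hTp)
  obtain ⟨b1, b2⟩ := summable_overlapWeight_right hT.left hT.right hS.left hS.right
    (fun i => Real.rpow_nonneg (hS.pos i).le p) (hS.summable hp0 hSp)
  have m1 := (hasSum_mixedEnergy hT hS one_pos hp hTp hSp).mul_left C
  have m2 := hasSum_mixedEnergy hT hS hr hrp hTp hSp
  -- The substochastic bounds make the right-hand sum at most `(C - 1)(Tr |T|^p + Tr |S|^p)`. On the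
  -- left the traces occur with coefficient `C - 1` too, so they cancel and only the energies
  -- remain.
  have hle := hasSum_le (fun x : ι × κ => ?_) (m1.sub m2)
    ((a1.hasSum.add b1.hasSum).mul_left (C - 1))
  · rw [← hT.toReal_schattenPow hp0] at a2
    rw [← hS.toReal_schattenPow hp0] at b2
    nlinarith
  · have h1 := hCk (t x.1) (s x.2) (hT.pos _) (hS.pos _)
    calc _ = (C * (t x.1 ^ (p - 1) * s x.2 ^ (1 : ℝ) + s x.2 ^ (p - 1) * t x.1 ^ (1 : ℝ))
          - (t x.1 ^ (p - r) * s x.2 ^ r + s x.2 ^ (p - r) * t x.1 ^ r)) * overlap e f g h x := by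
          ring
      _ ≤ |_| * |overlap e f g h x| := by rw [← abs_mul]; exact le_abs_self _
      _ ≤ ((C - 1) * (t x.1 ^ p + s x.2 ^ p)) * overlapWeight e f g h x :=
          mul_le_mul h1 (abs_overlap_le x) (abs_nonneg _) ((abs_nonneg _).trans h1)
      _ = _ := by ring

variable (H) in
/-- The modulus of continuity of `T ↦ sign(T)|T|^(p/q)` from the Schatten class of exponent `p` to that
of exponent `q` that integrates to a modulus of continuity on the Lebesgue-Bochner spaces. -/
def HasMazurModulus (p q : ℝ) [Fact (1 ≤ p)] : Prop :=
  ∀ ε : ℝ, 0 < ε → ∃ K : ℝ, 0 ≤ K ∧ ∀ T ∈ schattenIdeal H p, ∀ S ∈ schattenIdeal H p,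
    (schattenPow q (opMazur (p / q) T - opMazur (p / q) S)).toReal
      ≤ ε * ((schattenPow p T).toReal + (schattenPow p S).toReal)
        + K * (schattenPow p (T - S)).toReal

theorem opMazur_mem_schattenIdeal {p q : ℝ} [hp : Fact (1 ≤ p)] [hq : Fact (1 ≤ q)]
    {T : H →L[ℂ] H} (hT : T ∈ schattenIdeal H p) : opMazur (p / q) T ∈ schattenIdeal H q := by
  have hp0 : 0 < p := by linarith [hp.out]
  have hq0 : 0 < q := by linarith [hq.out]
  refine ⟨isCompactOperator_opMazur hT.1 (div_pos hp0 hq0), ?_⟩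
  have := schattenPow_opMazur T (div_pos hp0 hq0) hq0.le
  rw [div_mul_cancel₀ _ hq0.ne'] at this
  exact this.trans_lt hT.2

theorem hasMazurModulus_of_two_le {p q : ℝ} [Fact (1 ≤ p)] [Fact (1 ≤ q)] (hp : 1 < p)
    (hq : 2 ≤ q) : HasMazurModulus H p q := by
  intro ε hε
  have hp0 : 0 < p := by linarith
  have hq0 : 0 < q := by linarith
  have hr0 : 0 < p / q := div_pos hp0 hq0
  have hrp : p / q < p := div_lt_self hp0 (by linarith)
  have hrq : p / q * (q - 1) = p - p / q := by field_simp
  obtain ⟨C, hC0, hC⟩ := exists_mixedEnergy_le (H := H) hp hr0 hrp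
  set D := 2 ^ q * (q / 4) * C with hD
  have hD0 : 0 ≤ D := by positivity
  -- The energy bound is multiplied by `D` at the end; dividing by `D + 1` absorbs this without
  -- requiring `D ≠ 0`.
  obtain ⟨K, hK0, hK⟩ := exists_pairing_le (H := H) hp (ε := ε / (D + 1)) (by positivity)
  refine ⟨D * (2 * K), by positivity, fun T hTp S hSp => ?_⟩
  obtain ⟨ι, e, f, t, hT⟩ := exists_isSingularSystem hTp.1
  obtain ⟨κ, g, h, s, hS⟩ := exists_isSingularSystem hSp.1
  have fT := ne_top_of_mem_schattenIdeal hTp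
  have fS := ne_top_of_mem_schattenIdeal hSp
  have fD := ne_top_of_mem_schattenIdeal (Submodule.sub_mem _ hTp hSp)
  have fD' := ne_top_of_mem_schattenIdeal (Submodule.sub_mem _ hSp hTp)
  have h1 := schattenPow_sub_le_pairing hq (hT.map_opMazur hr0) (hS.map_opMazur hr0)
    (opMazur_mem_schattenIdeal (q := q) hTp) (opMazur_mem_schattenIdeal (q := q) hSp)
  -- The duality map of exponent `q` at `sign(T)|T|^(p/q)` is `sign(T)|T|^(p-p/q)`, so the
  -- monotonicity bound is a mixed energy of exponent `p / q`.
  have h2 : ∀ {ι : Type u} {T : H →L[ℂ] H} {e f : ι → H} {t : ι → ℝ} (Z : H →L[ℂ] H),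
      IsSingularSystem T e f t → singularPairing (q - 1) e f (fun i => t i ^ (p / q)) Z
        = singularPairing (p - p / q) e f t Z := by
    intro ι T e f t Z hT
    refine tsum_congr fun i => ?_
    rw [← Real.rpow_mul (hT.pos i).le, hrq]
  rw [h2 _ hT, h2 _ hS] at h1
  have h3 := hC hT hS fT fS
  have h4 := hK hT fT fD
  have h5 := hK hS fS fD'
  have h6 : schattenPow p (S - T) = schattenPow p (T - S) := by
    rw [schattenPow, schattenPow, ← neg_sub T S, star_neg, neg_mul_neg]
  rw [h6] at h5
  have h7 : mixedEnergy p 1 T S e f t g h s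
      = singularPairing (p - 1) e f t (T - S) + singularPairing (p - 1) g h s (S - T) := by
    rw [mixedEnergy, opMazur_one, opMazur_one]
  set a := (schattenPow p T).toReal
  set b := (schattenPow p S).toReal
  set d := (schattenPow p (T - S)).toReal
  have ha : 0 ≤ a := ENNReal.toReal_nonneg
  have hb : 0 ≤ b := ENNReal.toReal_nonneg
  have h8 : mixedEnergy p 1 T S e f t g h s ≤ ε / (D + 1) * (a + b) + 2 * K * d := by
    rw [h7]; linarith
  have h9 : D * (ε / (D + 1)) ≤ ε := by
    rw [mul_div_assoc', div_le_iff₀ (by positivity)]; nlinarith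
  calc _ ≤ 2 ^ q * (q / 4) * mixedEnergy p (p / q) T S e f t g h s := h1
    _ ≤ 2 ^ q * (q / 4) * (C * mixedEnergy p 1 T S e f t g h s) :=
        mul_le_mul_of_nonneg_left h3 (by positivity)
    _ = D * mixedEnergy p 1 T S e f t g h s := by rw [hD]; ring
    _ ≤ D * (ε / (D + 1) * (a + b) + 2 * K * d) := mul_le_mul_of_nonneg_left h8 hD0
    _ = D * (ε / (D + 1)) * (a + b) + D * (2 * K) * d := by ring
    _ ≤ _ := by gcongr

end Comparison
-- Hölder's inequality, the cube map, and arbitrary exponents.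
section Hoelder

universe u

variable {H : Type u} [NormedAddCommGroup H] [InnerProductSpace ℂ H] [CompleteSpace H]

open SchattenAux

/-- The families optimal for `A^*` are tested on `A` with their roles exchanged. -/
theorem schattenPow_star_le {A : H →L[ℂ] H} (hA : IsCompactOperator A) {p : ℝ} (hp : 1 ≤ p) :
    schattenPow p (star A) ≤ schattenPow p A := by
  obtain ⟨ι, e, f, he, hf, h⟩ := exists_tsum_inner_eq (isCompactOperator_star hA) (p := p)
    (by linarith)
  rw [schattenPow, ← h]
  refine le_trans (le_of_eq (tsum_congr fun i => ?_)) (tsum_inner_le hf he hp A)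
  rw [ContinuousLinearMap.star_eq_adjoint, ContinuousLinearMap.adjoint_inner_right, ← ofReal_norm,
    ← ofReal_norm, norm_inner_symm]

/-- Hölder's inequality in the Schatten classes, for factors of exponent at least two. -/
theorem schattenPow_mul_le {A B : H →L[ℂ] H} (hA : IsCompactOperator A) {p q r : ℝ} (hp : 2 ≤ p)
    (hq : 2 ≤ q) (hr : 0 < r) (hrp : r < p) (hpqr : 1 / r = 1 / p + 1 / q) :
    schattenPow r (A * B) ^ (1 / r) ≤ schattenPow p A ^ (1 / p) * schattenPow q B ^ (1 / q) := by
  obtain ⟨ι, e, f, he, hf, h⟩ := exists_tsum_inner_eq (T := A * B) (hA.comp_clm B) hr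
  rw [schattenPow, ← h]
  let : MeasurableSpace ι := ⊤
  -- With families optimal for `A B`, Hölder's inequality for sequences is applied to `‖A^* fᵢ‖` and
  -- `‖B eᵢ‖`, since `⟨fᵢ, A B eᵢ⟩ = ⟨A^* fᵢ, B eᵢ⟩`.
  have hm := ENNReal.lintegral_Lp_mul_le_Lq_mul_Lr hr hrp hpqr MeasureTheory.Measure.count
    (f := fun i : ι => ‖(star A) (f i)‖ₑ) (g := fun i : ι => ‖B (e i)‖ₑ)
    (Measurable.of_discrete.aemeasurable) (Measurable.of_discrete.aemeasurable)
  simp only [MeasureTheory.lintegral_count, Pi.mul_apply] at hm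
  refine le_trans ?_ (hm.trans ?_)
  · gcongr with i
    rw [op_mul_apply, ← ContinuousLinearMap.adjoint_inner_left, ← ContinuousLinearMap.star_eq_adjoint,
      ← ofReal_norm, ← ofReal_norm, ← ofReal_norm, ← ENNReal.ofReal_mul (norm_nonneg _)]
    exact ENNReal.ofReal_le_ofReal (norm_inner_le_norm _ _)
  · gcongr
    · exact (tsum_apply_rpow_le hf hp _).trans (schattenPow_star_le hA (by linarith))
    · exact tsum_apply_rpow_le he hq B

theorem schattenPow_mul_mul_le {A B C : H →L[ℂ] H} (hA : IsCompactOperator A)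
    (hB : IsCompactOperator B) {q : ℝ} (hq : 1 ≤ q) :
    schattenPow q (A * B * C) ^ (1 / q) ≤ schattenPow (3 * q) A ^ (1 / (3 * q)) *
      schattenPow (3 * q) B ^ (1 / (3 * q)) * schattenPow (3 * q) C ^ (1 / (3 * q)) := by
  have hq0 : 0 < q := by linarith
  -- The two-factor inequality needs both exponents at least two. Splitting the middle factor as `B
  -- = W R`, both halves of exponent `6q`, puts `A W` and `R C` in the class of exponent `2q ≥ 2`.
  set W := opMazur (1 / 2) B with hW
  set R := CFC.abs B ^ (1 / 2 : ℝ) with hR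
  have hB0 := CFC.abs_nonneg B
  have hWR : W * R = B := by
    rw [hW, hR, opMazur, mul_assoc, ← op_rpow_add (by norm_num) (by norm_num), add_halves,
      CFC.rpow_one _ hB0, (opSign_spec B).1]
  have hRc : IsCompactOperator R :=
    isCompactOperator_rpow hB0 (isCompactOperator_abs hB) (by norm_num)
  have hWp : schattenPow (6 * q) W = schattenPow (3 * q) B := by
    rw [hW, schattenPow_opMazur B (by norm_num) (by positivity)]; congr 1; ring
  have hRp : schattenPow (6 * q) R = schattenPow (3 * q) B := by
    rw [schattenPow_eq_abs _ (by positivity), CFC.abs_of_nonneg R CFC.rpow_nonneg, hR,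
      op_rpow_rpow hB0 (by norm_num) (by positivity), schattenPow_eq_abs _ (by positivity)]
    congr 2; ring
  have h1 := schattenPow_mul_le (A := A * W) (B := R * C) (hA.comp_clm W) (p := 2 * q) (q := 2 * q)
    (r := q) (by linarith) (by linarith) hq0 (by linarith) (by field_simp; norm_num)
  have h2 := schattenPow_mul_le (B := W) hA (p := 3 * q) (q := 6 * q) (r := 2 * q) (by linarith)
    (by linarith) (by linarith) (by linarith) (by field_simp; norm_num)
  have h3 := schattenPow_mul_le (B := C) hRc (p := 6 * q) (q := 3 * q) (r := 2 * q) (by linarith)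
    (by linarith) (by linarith) (by linarith) (by field_simp; norm_num)
  have h4 : A * B * C = A * W * (R * C) := by
    rw [← hWR]; simp only [mul_assoc]
  have h5 : schattenPow (3 * q) B ^ (1 / (3 * q))
      = schattenPow (3 * q) B ^ (1 / (6 * q)) * schattenPow (3 * q) B ^ (1 / (6 * q)) := by
    rw [← ENNReal.rpow_add_of_nonneg _ _ (by positivity) (by positivity)]
    congr 1; field_simp; norm_num
  rw [hWp] at h2
  rw [hRp] at h3
  rw [h4, h5]
  refine (h1.trans (mul_le_mul' h2 h3)).trans (le_of_eq ?_)
  ring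

theorem schattenPow_rpow_le_cube_sub {T S : H →L[ℂ] H} (hT : IsCompactOperator T)
    (hS : IsCompactOperator S) {q : ℝ} (hq : 1 ≤ q) :
    schattenPow q (opMazur 3 T - opMazur 3 S) ^ (1 / q)
      ≤ schattenPow (3 * q) (T - S) ^ (1 / (3 * q)) *
        (schattenPow (3 * q) T ^ (1 / (3 * q)) + schattenPow (3 * q) S ^ (1 / (3 * q))) ^ 2 := by
  have hq3 : 1 ≤ 3 * q := by linarith
  have hD : IsCompactOperator (T - S) := hT.sub hS
  have hTs := isCompactOperator_star hT
  have hSs := isCompactOperator_star hS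
  have hDs := isCompactOperator_star hD
  -- Telescoping `T T^* T - S S^* S`, one factor at a time.
  have hdec : opMazur 3 T - opMazur 3 S
      = ((T - S) * star T * T + S * star (T - S) * T) + S * star S * (T - S) := by
    rw [opMazur_three, opMazur_three, star_sub]; noncomm_ring
  set a := schattenPow (3 * q) T ^ (1 / (3 * q))
  set b := schattenPow (3 * q) S ^ (1 / (3 * q))
  set d := schattenPow (3 * q) (T - S) ^ (1 / (3 * q))
  have hstar : ∀ {A : H →L[ℂ] H}, IsCompactOperator A →
      schattenPow (3 * q) (star A) ^ (1 / (3 * q)) ≤ schattenPow (3 * q) A ^ (1 / (3 * q)) :=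
    fun hA => ENNReal.rpow_le_rpow (schattenPow_star_le hA hq3) (by positivity)
  have h1 : schattenPow q ((T - S) * star T * T) ^ (1 / q) ≤ d * a * a :=
    (schattenPow_mul_mul_le hD hTs hq).trans (by gcongr; exact hstar hT)
  have h2 : schattenPow q (S * star (T - S) * T) ^ (1 / q) ≤ b * d * a :=
    (schattenPow_mul_mul_le hS hDs hq).trans (by gcongr; exact hstar hD)
  have h3 : schattenPow q (S * star S * (T - S)) ^ (1 / q) ≤ b * b * d :=
    (schattenPow_mul_mul_le hS hSs hq).trans (by gcongr; exact hstar hS)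
  have c1 : IsCompactOperator ((T - S) * star T * T : H →L[ℂ] H) :=
    IsCompactOperator.comp_clm (f := ((T - S) * star T : H →L[ℂ] H)) (hD.comp_clm (star T)) T
  have c2 : IsCompactOperator (S * star (T - S) * T : H →L[ℂ] H) :=
    IsCompactOperator.comp_clm (f := (S * star (T - S) : H →L[ℂ] H)) (hS.comp_clm _) T
  have c3 : IsCompactOperator (S * star S * (T - S) : H →L[ℂ] H) :=
    IsCompactOperator.comp_clm (f := (S * star S : H →L[ℂ] H)) (hS.comp_clm _) _
  rw [hdec]
  calc _ ≤ _ := opTrace_rpow_add_le (c1.add c2) c3 hq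
    _ ≤ (d * a * a + b * d * a) + b * b * d :=
        add_le_add ((opTrace_rpow_add_le c1 c2 hq).trans (add_le_add h1 h2)) h3
    -- A second mixed term is added to complete the square.
    _ ≤ (d * a * a + b * d * a) + b * b * d + b * d * a := le_self_add
    _ = d * (a + b) ^ 2 := by ring

theorem hasMazurModulus_cube {q : ℝ} [hq : Fact (1 ≤ q)] [Fact (1 ≤ 3 * q)] :
    HasMazurModulus H (3 * q) q := by
  have hq0 : 0 < q := by linarith [hq.out]
  have hq3 : 0 < 3 * q := by linarith
  intro ε hε
  -- The `q`-th power of the cube estimate is `d^q (a + b)^(2q)`. The divisor `2^(3q)` compensates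
  -- for passing from `(a + b)^(3q)` to `a^(3q) + b^(3q)`.
  obtain ⟨K, hK0, hK⟩ := exists_young_epsilon (α := q) (β := 2 * q) (p := 3 * q) hq0
    (by linarith) (by ring) (ε := ε / 2 ^ (3 * q)) (by positivity)
  refine ⟨K, hK0, fun T hT S hS => ?_⟩
  have fT := ne_top_of_mem_schattenIdeal hT
  have fS := ne_top_of_mem_schattenIdeal hS
  have fD := ne_top_of_mem_schattenIdeal (Submodule.sub_mem _ hT hS)
  have h := schattenPow_rpow_le_cube_sub hT.1 hS.1 hq.out
  have hfin : ∀ {A : H →L[ℂ] H}, schattenPow (3 * q) A ≠ ⊤ →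
      schattenPow (3 * q) A ^ (1 / (3 * q)) ≠ ⊤ :=
    fun hA => ENNReal.rpow_ne_top_of_nonneg (by positivity) hA
  have h1 := ENNReal.toReal_mono (ENNReal.mul_ne_top (hfin fD)
    (ENNReal.pow_ne_top (ENNReal.add_ne_top.2 ⟨hfin fT, hfin fS⟩))) h
  rw [ENNReal.toReal_mul, ENNReal.toReal_pow, ENNReal.toReal_add (hfin fT) (hfin fS)] at h1
  simp only [← ENNReal.toReal_rpow] at h1
  rw [show 3 * q / q = 3 by field_simp]
  have hpw : ∀ A : H →L[ℂ] H, (schattenPow (3 * q) A).toReal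
      = ((schattenPow (3 * q) A).toReal ^ (1 / (3 * q))) ^ (3 * q) := by
    intro A
    rw [← Real.rpow_mul ENNReal.toReal_nonneg, one_div_mul_cancel hq3.ne', Real.rpow_one]
  rw [hpw T, hpw S, hpw (T - S)]
  set a := (schattenPow (3 * q) T).toReal ^ (1 / (3 * q))
  set b := (schattenPow (3 * q) S).toReal ^ (1 / (3 * q))
  set d := (schattenPow (3 * q) (T - S)).toReal ^ (1 / (3 * q))
  have ha : 0 ≤ a := Real.rpow_nonneg ENNReal.toReal_nonneg _
  have hb : 0 ≤ b := Real.rpow_nonneg ENNReal.toReal_nonneg _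
  have hd : 0 ≤ d := Real.rpow_nonneg ENNReal.toReal_nonneg _
  have h2 := Real.rpow_le_rpow (Real.rpow_nonneg ENNReal.toReal_nonneg _) h1 hq0.le
  rw [← Real.rpow_mul ENNReal.toReal_nonneg, one_div_mul_cancel hq0.ne', Real.rpow_one,
    Real.mul_rpow hd (by positivity), ← Real.rpow_natCast (a + b),
    ← Real.rpow_mul (x := a + b) (by positivity), Nat.cast_ofNat] at h2
  have h3 := hK d (a + b) hd (by positivity)
  have h4 : (a + b) ^ (3 * q) ≤ 2 ^ (3 * q) * (a ^ (3 * q) + b ^ (3 * q)) := by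
    have h5 : (a + b) ^ (3 * q) ≤ (2 * max a b) ^ (3 * q) :=
      Real.rpow_le_rpow (by positivity) (by linarith [le_max_left a b, le_max_right a b]) hq3.le
    rw [Real.mul_rpow two_pos.le (le_max_of_le_left ha)] at h5
    refine h5.trans (mul_le_mul_of_nonneg_left ?_ (by positivity))
    have h6 : 0 ≤ a ^ (3 * q) := by positivity
    have h7 : 0 ≤ b ^ (3 * q) := by positivity
    rcases le_total a b with hab | hab
    · rw [max_eq_right hab]; linarith
    · rw [max_eq_left hab]; linarith
  calc _ ≤ _ := h2
    _ ≤ _ := h3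
    _ ≤ ε / 2 ^ (3 * q) * (2 ^ (3 * q) * (a ^ (3 * q) + b ^ (3 * q))) + K * d ^ (3 * q) := by
        gcongr
    _ = _ := by field_simp

theorem HasMazurModulus.comp {p q s : ℝ} [hp : Fact (1 ≤ p)] [hq : Fact (1 ≤ q)]
    [hs : Fact (1 ≤ s)] (h1 : HasMazurModulus H p q) (h2 : HasMazurModulus H q s) :
    HasMazurModulus H p s := by
  have hp0 : 0 < p := by linarith [hp.out]
  have hq0 : 0 < q := by linarith [hq.out]
  have hs0 : 0 < s := by linarith [hs.out]
  intro ε hε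
  obtain ⟨K, hK0, hK⟩ := h2 (ε / 2) (by positivity)
  -- The tolerance of the inner map is fixed after `K`, which multiplies its error. The outer `ε /
  -- 2` term needs no adjustment, as the inner map preserves `‖T‖_p^p = ‖M T‖_q^q`.
  obtain ⟨L, hL0, hL⟩ := h1 (ε / 2 / (K + 1)) (by positivity)
  refine ⟨K * L, by positivity, fun T hT S hS => ?_⟩
  have h3 := hK _ (opMazur_mem_schattenIdeal (q := q) hT) _ (opMazur_mem_schattenIdeal (q := q) hS)
  have h4 := hL T hT S hS
  have hcomp : p / q * (q / s) = p / s := by field_simp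
  have hpow : ∀ A : H →L[ℂ] H, schattenPow q (opMazur (p / q) A) = schattenPow p A := by
    intro A
    rw [schattenPow_opMazur A (div_pos hp0 hq0) hq0.le, div_mul_cancel₀ _ hq0.ne']
  rw [opMazur_opMazur _ (div_pos hp0 hq0) (div_pos hq0 hs0),
    opMazur_opMazur _ (div_pos hp0 hq0) (div_pos hq0 hs0), hcomp, hpow, hpow] at h3
  have ha : 0 ≤ (schattenPow p T).toReal + (schattenPow p S).toReal :=
    add_nonneg ENNReal.toReal_nonneg ENNReal.toReal_nonneg
  have h5 : K * (ε / 2 / (K + 1)) ≤ ε / 2 := by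
    rw [mul_div_assoc', div_le_iff₀ (by positivity)]; nlinarith
  have h6 := mul_le_mul_of_nonneg_left h4 hK0
  have h7 := mul_le_mul_of_nonneg_right h5 ha
  nlinarith

/-- The Mazur map between Schatten classes is uniformly continuous on bounded sets. -/
theorem hasMazurModulus {p q : ℝ} [hp1 : Fact (1 ≤ p)] [hq1 : Fact (1 ≤ q)] (hp : 1 < p) :
    HasMazurModulus H p q := by
  have : Fact (1 ≤ 3 * q) := ⟨by linarith [hq1.out]⟩
  exact (hasMazurModulus_of_two_le (q := 3 * q) hp (by linarith [hq1.out])).comp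
    hasMazurModulus_cube

end Hoelder
-- The Mazur map on Schatten spaces, on Lebesgue-Bochner spaces, and on spheres.
section MazurMap

universe u

variable {H : Type u} [NormedAddCommGroup H] [InnerProductSpace ℂ H] [CompleteSpace H]

open MeasureTheory

namespace SchattenSpace

variable {p q : ℝ} [hp : Fact (1 ≤ p)] [hq : Fact (1 ≤ q)]

theorem norm_rpow (T : SchattenSpace H p) : ‖T‖ ^ p = (schattenPow p T.toOp).toReal := by
  have hp0 : 0 < p := by linarith [hp.out]
  rw [norm_def, ← ENNReal.toReal_rpow, ← Real.rpow_mul ENNReal.toReal_nonneg,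
    one_div_mul_cancel hp0.ne', Real.rpow_one]
  rfl

variable (p q) in
/-- The Mazur map `T ↦ sign(T) |T|^(p/q)` between Schatten spaces. -/
noncomputable def mazur (T : SchattenSpace H p) : SchattenSpace H q :=
  ⟨opMazur (p / q) T.toOp, opMazur_mem_schattenIdeal T.2⟩

theorem toOp_mazur (T : SchattenSpace H p) : (mazur p q T).toOp = opMazur (p / q) T.toOp := rfl

theorem norm_mazur_rpow (T : SchattenSpace H p) : ‖mazur p q T‖ ^ q = ‖T‖ ^ p := by
  have hp0 : 0 < p := by linarith [hp.out]
  have hq0 : 0 < q := by linarith [hq.out]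
  rw [norm_rpow, norm_rpow, toOp_mazur, schattenPow_opMazur _ (div_pos hp0 hq0) hq0.le,
    div_mul_cancel₀ _ hq0.ne']

theorem mazur_mazur (T : SchattenSpace H p) : mazur q p (mazur p q T) = T := by
  have hp0 : 0 < p := by linarith [hp.out]
  have hq0 : 0 < q := by linarith [hq.out]
  refine Subtype.ext ?_
  change opMazur (q / p) (opMazur (p / q) T.toOp) = T.toOp
  rw [opMazur_opMazur _ (div_pos hp0 hq0) (div_pos hq0 hp0), div_mul_div_cancel₀ hq0.ne',
    div_self hp0.ne', opMazur_one]

theorem exists_mazur_modulus (h1p : 1 < p) {ε : ℝ} (hε : 0 < ε) :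
    ∃ K : ℝ, 0 ≤ K ∧ ∀ T S : SchattenSpace H p,
      ‖mazur p q T - mazur p q S‖ ^ q ≤ ε * (‖T‖ ^ p + ‖S‖ ^ p) + K * ‖T - S‖ ^ p := by
  obtain ⟨K, hK0, hK⟩ := hasMazurModulus (H := H) (q := q) h1p ε hε
  refine ⟨K, hK0, fun T S => ?_⟩
  rw [norm_rpow, norm_rpow, norm_rpow, norm_rpow]
  exact hK T.toOp T.2 S.toOp S.2

/-- Needed so that composition with the Mazur map preserves strong measurability. -/
theorem continuous_mazur (h1p : 1 < p) :
    Continuous (mazur p q : SchattenSpace H p → SchattenSpace H q) := by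
  have hp0 : 0 < p := by linarith
  have hq0 : 0 < q := by linarith [hq.out]
  refine continuous_iff_continuousAt.2 fun T => Metric.tendsto_nhds.2 fun η hη => ?_
  have hηq : 0 < η ^ q := Real.rpow_pos_of_pos hη q
  have hTp : 0 ≤ ‖T‖ ^ p := Real.rpow_nonneg (norm_nonneg _) p
  -- The tolerance depends on `‖T‖`, so that the bound at `S = T` is strictly below `η^q`; by
  -- continuity it stays below for `S` near `T`.
  obtain ⟨K, -, hK⟩ := exists_mazur_modulus (H := H) (q := q) h1p
    (ε := η ^ q / (2 * ‖T‖ ^ p + 1)) (by positivity)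
  have hcont : Continuous fun S : SchattenSpace H p =>
      η ^ q / (2 * ‖T‖ ^ p + 1) * (‖S‖ ^ p + ‖T‖ ^ p) + K * ‖S - T‖ ^ p := by
    have h1 : Continuous fun S : SchattenSpace H p => ‖S‖ ^ p :=
      continuous_norm.rpow_const fun _ => Or.inr hp0.le
    have h2 : Continuous fun S : SchattenSpace H p => ‖S - T‖ ^ p :=
      (continuous_id.sub continuous_const).norm.rpow_const fun _ => Or.inr hp0.le
    fun_prop
  have hlt : η ^ q / (2 * ‖T‖ ^ p + 1) * (‖T‖ ^ p + ‖T‖ ^ p) + K * ‖T - T‖ ^ p < η ^ q := by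
    rw [sub_self, norm_zero, Real.zero_rpow hp0.ne', mul_zero, add_zero, div_mul_eq_mul_div,
      div_lt_iff₀ (by positivity)]
    nlinarith
  filter_upwards [hcont.continuousAt.eventually_lt continuousAt_const hlt] with S hS
  rw [dist_eq_norm]
  exact (Real.rpow_lt_rpow_iff (norm_nonneg _) hη.le hq0).1 ((hK S T).trans_lt hS)

end SchattenSpace

theorem enorm_rpow_eq_ofReal {E : Type*} [NormedAddCommGroup E] (x : E) {p : ℝ} (hp : 0 ≤ p) :
    ‖x‖ₑ ^ p = ENNReal.ofReal (‖x‖ ^ p) := by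
  rw [← ofReal_norm, ENNReal.ofReal_rpow_of_nonneg (norm_nonneg _) hp]

theorem MeasureTheory.eLpNorm_ofReal_rpow {X E : Type*} [MeasurableSpace X] {μ : Measure X}
    [NormedAddCommGroup E] (f : X → E) {p : ℝ} (hp : 0 < p) :
    eLpNorm f (ENNReal.ofReal p) μ ^ p = ∫⁻ x, ‖f x‖ₑ ^ p ∂μ := by
  rw [eLpNorm_eq_lintegral_rpow_enorm_toReal (ENNReal.ofReal_pos.2 hp).ne' ENNReal.ofReal_ne_top,
    ENNReal.toReal_ofReal hp.le, ← ENNReal.rpow_mul, one_div_mul_cancel hp.ne', ENNReal.rpow_one]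

theorem MeasureTheory.Lp.enorm_rpow {X E : Type*} [MeasurableSpace X] {μ : Measure X}
    [NormedAddCommGroup E] {p : ℝ} (hp : 0 < p) [Fact (1 ≤ ENNReal.ofReal p)]
    (f : Lp E (ENNReal.ofReal p) μ) : ‖f‖ₑ ^ p = ∫⁻ x, ‖f x‖ₑ ^ p ∂μ := by
  rw [Lp.enorm_def, eLpNorm_ofReal_rpow _ hp]

namespace SchattenLp

variable {X : Type*} [MeasurableSpace X] {μ : Measure X} {p q : ℝ} [hp : Fact (1 ≤ p)]
  [hq : Fact (1 ≤ q)]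

open SchattenSpace

theorem lintegral_mazur (f : X → SchattenSpace H p) :
    ∫⁻ x, ‖SchattenSpace.mazur p q (f x)‖ₑ ^ q ∂μ = ∫⁻ x, ‖f x‖ₑ ^ p ∂μ := by
  refine lintegral_congr fun x => ?_
  rw [enorm_rpow_eq_ofReal _ (by linarith [hq.out]), enorm_rpow_eq_ofReal _ (by linarith [hp.out]),
    norm_mazur_rpow]

theorem memLp_mazur (h1p : 1 < p) (f : SchattenLp μ H p) :
    MemLp (fun x => SchattenSpace.mazur p q (f x)) (ENNReal.ofReal q) μ := by
  have hq0 : 0 < q := by linarith [hq.out]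
  refine ⟨(continuous_mazur h1p).comp_aestronglyMeasurable (Lp.aestronglyMeasurable f), ?_⟩
  rw [← ENNReal.rpow_lt_top_iff_of_pos hq0, eLpNorm_ofReal_rpow _ hq0, lintegral_mazur,
    ← eLpNorm_ofReal_rpow _ (by linarith)]
  exact ENNReal.rpow_lt_top_of_nonneg (by linarith) (Lp.memLp f).2.ne

/-- The Mazur map between Lebesgue-Bochner spaces of Schatten-class valued functions. -/
noncomputable def mazur (q : ℝ) [Fact (1 ≤ q)] (h1p : 1 < p) (f : SchattenLp μ H p) :
    SchattenLp μ H q :=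
  (memLp_mazur (q := q) h1p f).toLp _

theorem coeFn_mazur (h1p : 1 < p) (f : SchattenLp μ H p) :
    mazur q h1p f =ᵐ[μ] fun x => SchattenSpace.mazur p q (f x) :=
  MemLp.coeFn_toLp _

theorem enorm_mazur_rpow (h1p : 1 < p) (f : SchattenLp μ H p) :
    ‖mazur q h1p f‖ₑ ^ q = ‖f‖ₑ ^ p := by
  rw [Lp.enorm_rpow (by linarith [hq.out]), Lp.enorm_rpow (by linarith),
    ← lintegral_mazur (p := p) (q := q) f]
  refine lintegral_congr_ae ?_
  filter_upwards [coeFn_mazur (q := q) h1p f] with x hx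
  rw [hx]

theorem norm_mazur_rpow (h1p : 1 < p) (f : SchattenLp μ H p) :
    ‖mazur q h1p f‖ ^ q = ‖f‖ ^ p := by
  have h := enorm_mazur_rpow (q := q) h1p f
  rwa [enorm_rpow_eq_ofReal _ (by linarith [hq.out]), enorm_rpow_eq_ofReal _ (by linarith),
    ENNReal.ofReal_eq_ofReal_iff (by positivity) (by positivity)] at h

theorem mazur_mazur (h1p : 1 < p) (h1q : 1 < q) (f : SchattenLp μ H p) :
    mazur p h1q (mazur q h1p f) = f := by
  refine Lp.ext ?_
  filter_upwards [coeFn_mazur (q := p) h1q (mazur q h1p f), coeFn_mazur (q := q) h1p f] with x h1 h2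
  rw [h1, h2, SchattenSpace.mazur_mazur]

/-- The pointwise modulus is integrated with the same `ε` and `K`, in `[0, ∞]`, and only then read
in the reals. -/
theorem exists_mazur_modulus (h1p : 1 < p) {ε : ℝ} (hε : 0 < ε) :
    ∃ K : ℝ, 0 ≤ K ∧ ∀ f g : SchattenLp μ H p,
      ‖mazur q h1p f - mazur q h1p g‖ ^ q ≤ ε * (‖f‖ ^ p + ‖g‖ ^ p) + K * ‖f - g‖ ^ p := by
  have hp0 : 0 < p := by linarith
  have hq0 : 0 < q := by linarith [hq.out]
  obtain ⟨K, hK0, hK⟩ := SchattenSpace.exists_mazur_modulus (H := H) (q := q) h1p hε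
  refine ⟨K, hK0, fun f g => ?_⟩
  have hofReal : ∀ x y z : ℝ, 0 ≤ x → 0 ≤ y → 0 ≤ z →
      ENNReal.ofReal (ε * (x + y) + K * z)
        = ENNReal.ofReal ε * (ENNReal.ofReal x + ENNReal.ofReal y)
          + ENNReal.ofReal K * ENNReal.ofReal z := by
    intro x y z hx hy hz
    rw [ENNReal.ofReal_add (by positivity) (by positivity), ENNReal.ofReal_mul hε.le,
      ENNReal.ofReal_mul hK0, ENNReal.ofReal_add hx hy]
  have key : ‖mazur q h1p f - mazur q h1p g‖ₑ ^ q
      ≤ ENNReal.ofReal ε * (‖f‖ₑ ^ p + ‖g‖ₑ ^ p) + ENNReal.ofReal K * ‖f - g‖ₑ ^ p := by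
    have hmeas : ∀ f : SchattenLp μ H p, AEMeasurable (fun x => ‖f x‖ₑ ^ p) μ := fun f =>
      (Lp.aestronglyMeasurable f).enorm.pow_const p
    rw [Lp.enorm_rpow hq0, Lp.enorm_rpow hp0, Lp.enorm_rpow hp0, Lp.enorm_rpow hp0,
      ← lintegral_add_left' (hmeas f), ← lintegral_const_mul' _ _ ENNReal.ofReal_ne_top,
      ← lintegral_const_mul' _ _ ENNReal.ofReal_ne_top,
      ← lintegral_add_left' (f := fun x => ENNReal.ofReal ε * (‖f x‖ₑ ^ p + ‖g x‖ₑ ^ p))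
        (((hmeas f).add (hmeas g)).const_mul _)]
    refine lintegral_mono_ae ?_
    filter_upwards [coeFn_mazur (q := q) h1p f, coeFn_mazur (q := q) h1p g,
      Lp.coeFn_sub (mazur q h1p f) (mazur q h1p g), Lp.coeFn_sub f g] with x h1 h2 h3 h4
    rw [h3, h4, Pi.sub_apply, Pi.sub_apply, h1, h2, enorm_rpow_eq_ofReal _ hq0.le,
      enorm_rpow_eq_ofReal _ hp0.le, enorm_rpow_eq_ofReal _ hp0.le, enorm_rpow_eq_ofReal _ hp0.le,
      ← hofReal _ _ _ (by positivity) (by positivity) (by positivity)]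
    exact ENNReal.ofReal_le_ofReal (hK _ _)
  rw [enorm_rpow_eq_ofReal _ hq0.le, enorm_rpow_eq_ofReal _ hp0.le, enorm_rpow_eq_ofReal _ hp0.le,
    enorm_rpow_eq_ofReal _ hp0.le,
    ← hofReal _ _ _ (by positivity) (by positivity) (by positivity)] at key
  exact (ENNReal.ofReal_le_ofReal_iff (by positivity)).1 key

theorem norm_mazur_eq_one (h1p : 1 < p) {f : SchattenLp μ H p} (hf : ‖f‖ = 1) :
    ‖mazur q h1p f‖ = 1 := by
  have hq0 : 0 < q := by linarith [hq.out]
  have h := norm_mazur_rpow (q := q) h1p f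
  rw [hf, Real.one_rpow] at h
  exact (Real.rpow_left_inj (norm_nonneg _) zero_le_one hq0.ne').1 (by rw [h, Real.one_rpow])

variable (H μ) in
/-- The Mazur map on the unit sphere. -/
noncomputable def mazurSphere (q : ℝ) [Fact (1 ≤ q)] (h1p : 1 < p)
    (f : Metric.sphere (0 : SchattenLp μ H p) 1) : Metric.sphere (0 : SchattenLp μ H q) 1 :=
  ⟨mazur q h1p f.1, mem_sphere_zero_iff_norm.2
    (norm_mazur_eq_one h1p (mem_sphere_zero_iff_norm.1 f.2))⟩

theorem uniformContinuous_mazurSphere (h1p : 1 < p) :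
    UniformContinuous (mazurSphere H μ q h1p) := by
  have hp0 : 0 < p := by linarith
  have hq0 : 0 < q := by linarith [hq.out]
  refine Metric.uniformContinuous_iff.2 fun η hη => ?_
  have hηq : 0 < η ^ q := Real.rpow_pos_of_pos hη q
  -- On the sphere `‖f‖^p + ‖g‖^p = 2`, so the tolerance `η^q / 4` uses up half of `η^q`. The
  -- constant `c` keeps the other term strictly below the other half.
  obtain ⟨K, hK0, hK⟩ := exists_mazur_modulus (μ := μ) (H := H) (q := q) h1p
    (ε := η ^ q / 4) (by positivity)
  set c := η ^ q / 2 / (K + 1) with hc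
  have hc0 : 0 < c := by positivity
  refine ⟨c ^ p⁻¹, Real.rpow_pos_of_pos hc0 _, fun {f g} hfg => ?_⟩
  have hf : ‖f.1‖ = 1 := mem_sphere_zero_iff_norm.1 f.2
  have hg : ‖g.1‖ = 1 := mem_sphere_zero_iff_norm.1 g.2
  rw [Subtype.dist_eq, dist_eq_norm] at hfg ⊢
  have h1 := hK f.1 g.1
  rw [hf, hg, Real.one_rpow] at h1
  have h2 : ‖f.1 - g.1‖ ^ p ≤ c := by
    have := Real.rpow_le_rpow (norm_nonneg _) hfg.le hp0.le
    rwa [← Real.rpow_mul hc0.le, inv_mul_cancel₀ hp0.ne', Real.rpow_one] at this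
  have h3 : K * c < η ^ q / 2 := by
    rw [hc, mul_div_assoc', div_lt_iff₀ (by positivity)]; nlinarith
  have h4 := mul_le_mul_of_nonneg_left h2 hK0
  refine (Real.rpow_lt_rpow_iff (norm_nonneg _) hη.le hq0).1 ?_
  change ‖mazur q h1p f.1 - mazur q h1p g.1‖ ^ q < η ^ q
  linarith

end SchattenLp

end MazurMap

theorem corollary5p7 {X : Type*} [MeasurableSpace X] (μ : MeasureTheory.Measure X)
    {H : Type*} [NormedAddCommGroup H] [InnerProductSpace ℂ H] [CompleteSpace H]
    {p q : ℝ} [Fact (1 ≤ p)] [Fact (1 ≤ q)] (hp : 1 < p) (hq : 1 < q) :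
    ∃ M : Metric.sphere (0 : SchattenLp μ H p) 1 ≃ₜ Metric.sphere (0 : SchattenLp μ H q) 1,
      (∀ f : Metric.sphere (0 : SchattenLp μ H p) 1, ∀ᵐ x ∂μ,
        ((M f : SchattenLp μ H q) x).toOp = opMazur (p / q) ((f : SchattenLp μ H p) x).toOp) ∧
      UniformContinuous M ∧ UniformContinuous M.symm := by
  refine ⟨⟨⟨SchattenLp.mazurSphere H μ q hp, SchattenLp.mazurSphere H μ p hq, fun f => ?_,
    fun f => ?_⟩, (SchattenLp.uniformContinuous_mazurSphere hp).continuous,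
    (SchattenLp.uniformContinuous_mazurSphere hq).continuous⟩, fun f => ?_,
    SchattenLp.uniformContinuous_mazurSphere hp, SchattenLp.uniformContinuous_mazurSphere hq⟩
  · exact Subtype.ext (SchattenLp.mazur_mazur hp hq f.1)
  · exact Subtype.ext (SchattenLp.mazur_mazur hq hp f.1)
  · filter_upwards [SchattenLp.coeFn_mazur (q := q) hp f.1] with x hx
    exact (congrArg SchattenSpace.toOp hx).trans (SchattenSpace.toOp_mazur _)
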